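/- **Setting.** Let $V$ be a complex vector space with basis $E=\{e_1,e_2,\dots\}$ and $V_n=\mathrm{Span}\{e_1,\dots,e_n\}$. Let $SL(\infty;\mathbb C)=\bigcup_n SL(n;\mathbb C)$, where $SL(n;\mathbb C)$ acts on $V_n$ and fixes $e_j$ for $j>n$. Let $\tau:V\to V$ be the conjugate linear map with $\tau e_a=e_a$ for all $a$ (case $\mathbb F=\mathbb R$), or with $\tau e_{2a-1}=-e_{2a}$ and $\tau e_{2a}=e_{2a-1}$ for all $a\geq 1$ (case $\mathbb F=\mathbb H$). Let $G_0=SL(\infty;\mathbb F)=\{g\in SL(\infty;\mathbb C)\mid g\tau=\tau g\}$. **Generalized flags.** For a chain $\mathcal F$ of subspaces of $V$, let $\mathcal F^\dagger$ be the set of pairs $(F',F'')$ in $\mathcal F$ such that $F''$ is the immediate successor of $F'$. The chain $\mathcal F$ is a *generalized flag* if each of its members has an immediate successor or an immediate predecessor in $\mathcal F$, and $V\setminus\{0\}=\bigcup_{(F',F'')\in\mathcal F^\dagger}(F''\setminus F')$. It is *compatible* with a basis $X=\{x_\alpha\}$ of $V$ if there is a strict partial order $\prec$ on the index set, for which incomparability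 is transitive, such that every $(F',F'')\in\mathcal F^\dagger$ is $(\mathrm{Span}\{x_\beta\mid\beta\prec\alpha\},\mathrm{Span}\{x_\beta\mid\alpha\not\prec\beta\})$ for some $\alpha$. It is *weakly compatible* with $E$ if it is compatible with a basis that contains all but finitely many elements of $E$. Generalized flags $\mathcal L,\mathcal M$ are *$E$-commensurable* if both are weakly compatible with $E$ and there are a bijection $\varphi:\mathcal L\to\mathcal M$ and a finite dimensional $U\subset V$ such that $L\subset\varphi(L)+U$, $\varphi(L)\subset L+U$ and $\dim(L\cap U)=\dim(\varphi(L)\cap U)$ for all $L\in\mathcal L$; such a $\varphi$ is unique. **Flag manifold.** Let $\mathcal F$ be a generalized flag compatible with $E$. The flag manifold $\mathcal Z_{\mathcal F,E}$ is the set of all generalized flags $E$-commensurable to $\mathcal F$. It carries the direct limit topology of the finite dimensional flag manifolds $SL(n;\mathbb C)(\mathcal F)$: a subset $A$ is open if and only if $\{g\in SL(n;\mathbb C)\mid g(\mathcal F)\in A\}$ is open in $SL(n;\mathbb C)$ for every $n$. A flag $\mathcal L\in\mathcal Z_{\mathcal F,E}$ is *nondegenerate* if, for all $\mathcal M\in\mathcal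 Z_{\mathcal F,E}$ and all $L,L'\in\mathcal L$, the space $L\cap\tau L'$ does not properly contain $\varphi(L)\cap\tau\varphi(L')$, where $\varphi:\mathcal L\to\mathcal M$ is the bijection above. **Corollary.** Let $G_0$ be $SL(\infty;\mathbb R)$ or $SL(\infty;\mathbb H)$, and let $\mathcal F$ be a generalized flag in $V$ compatible with $E$. There is an open $G_0$-orbit on $\mathcal Z_{\mathcal F,E}$ if and only if $\mathcal Z_{\mathcal F,E}$ contains a nondegenerate flag, and in that case there is exactly one open $G_0$-orbit on $\mathcal Z_{\mathcal F,E}$. -/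

import Mathlib

namespace DirectLimitFlag

noncomputable section

variable {V : Type*} [AddCommGroup V] [Module ℂ V]

/-! ### The group `SL(∞; ℂ) = SL(V, E)` as the increasing union of the groups `SL(n; ℂ)` -/

/-- The linear map of `V` that acts by the matrix `A` on the span of `E 0, …, E (n - 1)` and fixes
`E j` for `j ≥ n`. -/
def matrixMap (E : Module.Basis ℕ ℂ V) (n : ℕ) (A : Matrix (Fin n) (Fin n) ℂ) : V →ₗ[ℂ] V :=
  E.constr ℂ fun j => if h : j < n then ∑ i : Fin n, A i ⟨j, h⟩ • E i else E j

theorem matrixMap_lt (E : Module.Basis ℕ ℂ V) {n : ℕ} (A : Matrix (Fin n) (Fin n) ℂ) (j : Fin n) :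
    matrixMap E n A (E j) = ∑ i : Fin n, A i j • E i := by
  simp [matrixMap, Module.Basis.constr_basis]

theorem matrixMap_ge (E : Module.Basis ℕ ℂ V) {n : ℕ} (A : Matrix (Fin n) (Fin n) ℂ) {j : ℕ}
    (h : n ≤ j) : matrixMap E n A (E j) = E j := by
  simp [matrixMap, Module.Basis.constr_basis, Nat.not_lt.mpr h]

theorem matrixMap_one (E : Module.Basis ℕ ℂ V) (n : ℕ) : matrixMap E n 1 = 1 := by
  refine E.ext fun j => ?_
  rcases lt_or_ge j n with h | h
  · rw [show E j = E ((⟨j, h⟩ : Fin n) : ℕ) from rfl, matrixMap_lt]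
    simp [Matrix.one_apply]
  · simp [matrixMap_ge E _ h]

theorem matrixMap_mul (E : Module.Basis ℕ ℂ V) (n : ℕ) (A B : Matrix (Fin n) (Fin n) ℂ) :
    matrixMap E n (A * B) = matrixMap E n A * matrixMap E n B := by
  refine E.ext fun j => ?_
  rcases lt_or_ge j n with h | h
  · rw [show E j = E ((⟨j, h⟩ : Fin n) : ℕ) from rfl, Module.End.mul_apply, matrixMap_lt,
      matrixMap_lt, map_sum]
    simp only [map_smul, matrixMap_lt, Finset.smul_sum, Matrix.mul_apply, Finset.sum_smul, smul_smul]
    rw [Finset.sum_comm]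
    simp only [mul_comm]
  · simp [matrixMap_ge E _ h]

/-- The inclusion `SL(n; ℂ) → GL(V)`, the identity on `E j` for `j ≥ n`. -/
def slHom (E : Module.Basis ℕ ℂ V) (n : ℕ) :
    Matrix.SpecialLinearGroup (Fin n) ℂ →* LinearMap.GeneralLinearGroup ℂ V :=
  MonoidHom.toHomUnits
    { toFun := fun A => matrixMap E n A.1
      map_one' := by simp [matrixMap_one]
      map_mul' := fun A B => by simp [matrixMap_mul] }

theorem coe_slHom (E : Module.Basis ℕ ℂ V) (n : ℕ) (A : Matrix.SpecialLinearGroup (Fin n) ℂ) :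
    (slHom E n A : V →ₗ[ℂ] V) = matrixMap E n A.1 := rfl

/-- The images of the groups `SL(n; ℂ)` increase with `n`. -/
theorem slHom_range_mono (E : Module.Basis ℕ ℂ V) : Monotone fun n => (slHom E n).range := by
  intro n m hnm
  obtain ⟨k, rfl⟩ := Nat.exists_eq_add_of_le hnm
  rintro _ ⟨A, rfl⟩
  refine ⟨⟨Matrix.reindex finSumFinEquiv finSumFinEquiv
    (Matrix.fromBlocks A.1 0 0 (1 : Matrix (Fin k) (Fin k) ℂ)), ?_⟩, ?_⟩
  · rw [Matrix.det_reindex_self, Matrix.det_fromBlocks_zero₂₁, Matrix.det_one, mul_one, A.2]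
  · refine Units.ext (E.ext fun j => ?_)
    change matrixMap E (n + k) (Matrix.reindex finSumFinEquiv finSumFinEquiv
      (Matrix.fromBlocks A.1 0 0 (1 : Matrix (Fin k) (Fin k) ℂ))) (E j) = matrixMap E n A.1 (E j)
    rcases lt_or_ge j n with h | h
    · have e1 : E j = E ((Fin.castAdd k ⟨j, h⟩ : Fin (n + k)) : ℕ) := rfl
      conv_lhs => rw [e1, matrixMap_lt]
      conv_rhs => rw [show E j = E ((⟨j, h⟩ : Fin n) : ℕ) from rfl, matrixMap_lt]
      have e2 : finSumFinEquiv.symm (⟨j, by omega⟩ : Fin (n + k)) = Sum.inl ⟨j, h⟩ :=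
        finSumFinEquiv_symm_apply_castAdd ⟨j, h⟩
      rw [Fin.sum_univ_add]
      simp [Matrix.reindex_apply, e2]
    · rw [matrixMap_ge E A.1 h]
      rcases lt_or_ge j (n + k) with h' | h'
      · obtain ⟨l, rfl⟩ := Nat.exists_eq_add_of_le h
        have hl : l < k := by omega
        have e1 : E (n + l) = E ((Fin.natAdd n ⟨l, hl⟩ : Fin (n + k)) : ℕ) := rfl
        conv_lhs => rw [e1, matrixMap_lt]
        have e2 : finSumFinEquiv.symm (⟨n + l, h'⟩ : Fin (n + k)) = Sum.inr ⟨l, hl⟩ :=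
          finSumFinEquiv_symm_apply_natAdd ⟨l, hl⟩
        rw [Fin.sum_univ_add]
        simp [Matrix.reindex_apply, Matrix.one_apply, e2]
      · exact matrixMap_ge E _ h'

/-- `SL(∞; ℂ) = SL(V, E)`, the union over `n` of the groups `SL(n; ℂ)`. -/
def specialLinear (E : Module.Basis ℕ ℂ V) : Subgroup (LinearMap.GeneralLinearGroup ℂ V) where
  carrier := {g | ∃ n, g ∈ (slHom E n).range}
  one_mem' := ⟨0, one_mem _⟩
  mul_mem' := by
    rintro a b ⟨n, ha⟩ ⟨m, hb⟩
    exact ⟨max n m, mul_mem (slHom_range_mono E (le_max_left n m) ha)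
      (slHom_range_mono E (le_max_right n m) hb)⟩
  inv_mem' := by
    rintro a ⟨n, ha⟩
    exact ⟨n, inv_mem ha⟩

/-! ### The conjugate linear maps `τ` and the real forms `SL(∞; ℝ)` and `SL(∞; ℍ)` -/

/-- The two cases `𝔽 = ℝ` and `𝔽 = ℍ`. -/
inductive ScalarCase where
  | real
  | quaternion

/-- The values of `τ` on the basis. The basis is indexed from `0` on, so that in the quaternionic
case `τ (E (2 a)) = - E (2 a + 1)` and `τ (E (2 a + 1)) = E (2 a)`. -/
def tauBasis (E : Module.Basis ℕ ℂ V) : ScalarCase → ℕ → V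
  | .real, j => E j
  | .quaternion, j => if Even j then -E (j + 1) else E (j - 1)

/-- The conjugate linear map `τ` of `V`: the conjugate linear extension of `tauBasis`. -/
def tau (E : Module.Basis ℕ ℂ V) (𝔽 : ScalarCase) : V →ₛₗ[starRingEnd ℂ] V where
  toFun v := Finsupp.linearCombination ℂ (tauBasis E 𝔽)
    (Finsupp.mapRange (starRingEnd ℂ) (map_zero _) (E.repr v))
  map_add' v w := by
    rw [map_add, Finsupp.mapRange_add (map_add _), map_add]
  map_smul' c v := by
    rw [← map_smul]
    congr 1
    ext j
    simp

/-- The real form `G₀` of `SL(∞; ℂ)`: all `g ∈ SL(V, E)` that commute with `τ`. This is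
`SL(∞; ℝ)`, respectively `SL(∞; ℍ)`. -/
def realForm (E : Module.Basis ℕ ℂ V) (𝔽 : ScalarCase) :
    Subgroup (LinearMap.GeneralLinearGroup ℂ V) where
  carrier := {g | g ∈ specialLinear E ∧
    ∀ v, (g : V →ₗ[ℂ] V) (tau E 𝔽 v) = tau E 𝔽 ((g : V →ₗ[ℂ] V) v)}
  one_mem' := ⟨one_mem _, fun _ => rfl⟩
  mul_mem' := by
    rintro a b ⟨ha, ha'⟩ ⟨hb, hb'⟩
    refine ⟨mul_mem ha hb, fun v => ?_⟩
    rw [Units.val_mul, Module.End.mul_apply, Module.End.mul_apply, hb', ha']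
  inv_mem' := by
    rintro a ⟨ha, ha'⟩
    refine ⟨inv_mem ha, fun v => ?_⟩
    have h1 : ∀ w, (a⁻¹).val (a.val w) = w := fun w => by
      rw [← Module.End.mul_apply, Units.inv_mul, Module.End.one_apply]
    have h2 : ∀ w, a.val ((a⁻¹).val w) = w := fun w => by
      rw [← Module.End.mul_apply, Units.mul_inv, Module.End.one_apply]
    have h3 := ha' ((a⁻¹).val v)
    rw [h2] at h3
    rw [← h3, h1]

/-! ### Generalized flags -/

/-- `(P, S) ∈ 𝓕†`: `S` is the immediate successor of `P` in the chain `𝓕`. -/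
def IsImmediatePair (𝓕 : Set (Submodule ℂ V)) (P S : Submodule ℂ V) : Prop :=
  P ∈ 𝓕 ∧ S ∈ 𝓕 ∧ P < S ∧ ∀ W ∈ 𝓕, ¬ (P < W ∧ W < S)

/-- A generalized flag: a chain of subspaces in which every member has an immediate successor or an
immediate predecessor, and such that every nonzero vector lies in `S \ P` for some
`(P, S) ∈ 𝓕†`. -/
structure IsGeneralizedFlag (𝓕 : Set (Submodule ℂ V)) : Prop where
  chain : ∀ P ∈ 𝓕, ∀ S ∈ 𝓕, P ≤ S ∨ S ≤ P
  pair : ∀ W ∈ 𝓕, (∃ S, IsImmediatePair 𝓕 W S) ∨ (∃ P, IsImmediatePair 𝓕 P W)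
  cover : ∀ v : V, v ≠ 0 → ∃ P S, IsImmediatePair 𝓕 P S ∧ v ∈ S ∧ v ∉ P

/-- Compatibility of a generalized flag with a basis `X`: there is a strict partial order `≺` on the
basis, in which incomparability is transitive, such that every `(P, S) ∈ 𝓕†` has the form
`P = Span {X β | β ≺ α}`, `S = Span {X β | β ≼ α}`, where `β ≼ α` means that `β ≺ α` or that
`α` and `β` are incomparable (or equal), that is, that `α ≺ β` fails. -/
def IsCompatible (X : Module.Basis ℕ ℂ V) (𝓕 : Set (Submodule ℂ V)) : Prop :=
  ∃ prec : ℕ → ℕ → Prop, IsStrictWeakOrder ℕ prec ∧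
    ∀ P S, IsImmediatePair 𝓕 P S → ∃ α : ℕ,
      P = Submodule.span ℂ (X '' {β | prec β α}) ∧
      S = Submodule.span ℂ (X '' {β | ¬ prec α β})

/-- Weak compatibility with `E`: compatibility with a basis that contains all but finitely many
elements of `E`. -/
def IsWeaklyCompatible (E : Module.Basis ℕ ℂ V) (𝓕 : Set (Submodule ℂ V)) : Prop :=
  ∃ X : Module.Basis ℕ ℂ V, (Set.range E \ Set.range X).Finite ∧ IsCompatible X 𝓕

/-- The bijection `φ : 𝓕 → 𝓖` moves each member only within a finite dimensional subspace `U`, in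
the sense of the definition of commensurability. -/
def IsCommensuration {𝓕 𝓖 : Set (Submodule ℂ V)} (φ : 𝓕 ≃ 𝓖) : Prop :=
  ∃ U : Submodule ℂ V, FiniteDimensional ℂ U ∧ ∀ W : 𝓕,
    W.1 ≤ (φ W).1 ⊔ U ∧ (φ W).1 ≤ W.1 ⊔ U ∧
    Module.finrank ℂ ↥(W.1 ⊓ U) = Module.finrank ℂ ↥((φ W).1 ⊓ U)

/-- `E`-commensurability of generalized flags. -/
def AreCommensurable (E : Module.Basis ℕ ℂ V) (𝓕 𝓖 : Set (Submodule ℂ V)) : Prop :=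
  IsWeaklyCompatible E 𝓕 ∧ IsWeaklyCompatible E 𝓖 ∧ ∃ φ : 𝓕 ≃ 𝓖, IsCommensuration φ

/-! ### The flag manifold, its topology, and the orbits of the real form -/

/-- The flag manifold `𝓩_{𝓕,E}`: all generalized flags that are `E`-commensurable to `𝓕`. -/
def FlagManifold (E : Module.Basis ℕ ℂ V) (𝓕 : Set (Submodule ℂ V)) : Type _ :=
  {L : Set (Submodule ℂ V) // IsGeneralizedFlag L ∧ AreCommensurable E 𝓕 L}

/-- The image `g(𝓕)` of a family of subspaces under `g`. -/
def moveFlag (g : LinearMap.GeneralLinearGroup ℂ V) (𝓕 : Set (Submodule ℂ V)) :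
    Set (Submodule ℂ V) :=
  (fun W => W.map (g : V →ₗ[ℂ] V)) '' 𝓕

/-- The direct limit topology of `𝓩_{𝓕,E} = lim 𝓩_n`, where `𝓩_n` is the finite dimensional flag
manifold `SL(n; ℂ)(𝓕) = SL(n; ℂ) / Q_n` with its quotient topology: a subset is open exactly if for
all `n` its preimage under `g ↦ g(𝓕)` is open in `SL(n; ℂ)`. -/
instance instTopologicalSpaceFlagManifold (E : Module.Basis ℕ ℂ V) (𝓕 : Set (Submodule ℂ V)) :
    TopologicalSpace (FlagManifold E 𝓕) :=
  TopologicalSpace.induced Subtype.val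
    (⨆ n : ℕ, TopologicalSpace.coinduced
      (fun A : Matrix.SpecialLinearGroup (Fin n) ℂ => moveFlag (slHom E n A) 𝓕) inferInstance)

/-- The orbit `G₀(L)` in `𝓩_{𝓕,E}`. -/
def realOrbit {E : Module.Basis ℕ ℂ V} {𝓕 : Set (Submodule ℂ V)} (𝔽 : ScalarCase)
    (L : FlagManifold E 𝓕) : Set (FlagManifold E 𝓕) :=
  {M | ∃ g ∈ realForm E 𝔽, M.1 = moveFlag g L.1}

/-- `D` is an open `G₀`-orbit on `𝓩_{𝓕,E}`. -/
def IsOpenOrbit {E : Module.Basis ℕ ℂ V} {𝓕 : Set (Submodule ℂ V)} (𝔽 : ScalarCase)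
    (D : Set (FlagManifold E 𝓕)) : Prop :=
  (∃ L, D = realOrbit 𝔽 L) ∧ IsOpen D

/-- `L ∈ 𝓩_{𝓕,E}` is nondegenerate: for all members `L_i`, `L_j` of `L` and all `M ∈ 𝓩_{𝓕,E}`, the
space `L_i ∩ τ L_j` does not properly contain `M_i ∩ τ M_j`. Here `M_i = φ(L_i)` for the bijection
`φ` that exhibits `L` and `M` as commensurable; this bijection is unique. -/
def IsNondegenerate {E : Module.Basis ℕ ℂ V} {𝓕 : Set (Submodule ℂ V)} (𝔽 : ScalarCase)
    (L : FlagManifold E 𝓕) : Prop :=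
  ∀ (M : FlagManifold E 𝓕) (φ : L.1 ≃ M.1), IsCommensuration φ → ∀ W W' : L.1,
    ¬ ((φ W).1 ⊓ (φ W').1.map (tau E 𝔽) < W.1 ⊓ W'.1.map (tau E 𝔽))

end

end DirectLimitFlag

/-! Call a flag L transversal if any two members W, W' satisfy W ∩ τW' = 0 or W + τW' = V
(`IsTransversal`). The proof shows that nondegenerate means transversal, that every flag in an open
orbit is transversal, and that the transversal flags, if there are any, form a single G₀-orbit,
which is open. The corollary follows at once.

Suppose a pair W, W' is not transversal. Some transvection v ↦ v + tξ(v)y with ξ(y) = 0 then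
strictly shrinks W ∩ τW' for every t ≠ 0 (`exists_shear_lt`), so L is not nondegenerate. If the
orbit of L were open, then for small t the sheared flag would be gL with g in G₀. As g commutes with
τ, it would carry W ∩ τW' to a proper subspace of itself; but g acts inside a finite dimensional
space, which forbids this. Conversely, transversal flags are nondegenerate by a dimension count in
the first m coordinates.

Transitivity (`exists_realForm_eq_moveFlag`): two flags of the manifold agree beyond some coordinate
m, and corresponding members have equal dimension before it. Transversality determines the
dimensions of all W ∩ τW' there, and these classify pairs of chains up to linear isomorphism, as in
the Bruhat decomposition (`exists_equiv_of_chains`). So some g carries (L, τL) to (M, τM). For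
suitable a the map a·g + ā·τgτ⁻¹ is invertible, commutes with τ and still carries L to M. Its
determinant is real, and nonnegative in the quaternionic case, so a diagonal map on two coordinates
along which L is a coordinate flag corrects it to 1.

Openness (`isOpen_setOf_isTransversal`): relative to one transversal flag, transversality is a lower
bound on ranks in ℂ^m. Even an infinite flag meets ℂ^m in finitely many coordinate subspaces, so
only finitely many such conditions occur. -/

namespace DirectLimitFlag

open Module Topology

/-! ### Pairs of chains in a finite dimensional space -/

section Chains

universe u v

variable {K : Type*} [Field K]

/-- The decomposition of a space along a vector `v` and a functional `f` with `f v = 1`. -/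
def splitEquiv {W : Type*} [AddCommGroup W] [Module K W] (f : Dual K W) (v : W) (hf : f v = 1) :
    W ≃ₗ[K] LinearMap.ker f × K where
  toFun w := (⟨w - f w • v, by simp [hf]⟩, f w)
  map_add' a b := by
    ext
    · simp [add_smul]; abel
    · simp
  map_smul' c a := by
    ext
    · simp [smul_sub, smul_smul]
    · simp
  invFun p := p.1 + p.2 • v
  left_inv w := by simp
  right_inv p := by
    have : f (p.1 : W) = 0 := p.1.2
    ext <;> simp [hf, this]

theorem finrank_eq_comap_ker_add {W : Type*} [AddCommGroup W] [Module K W] [FiniteDimensional K W]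
    {f : Dual K W} {v : W} (hf : f v = 1) {X : Submodule K W} (hX : v ∈ X ∨ X ≤ LinearMap.ker f)
    [Decidable (v ∈ X)] :
    finrank K X = finrank K (X.comap (LinearMap.ker f).subtype) + if v ∈ X then 1 else 0 := by
  have h0 : finrank K (X.comap (LinearMap.ker f).subtype) = finrank K ↥(LinearMap.ker f ⊓ X) := by
    rw [← Submodule.finrank_map_subtype_eq, Submodule.map_comap_subtype]
  have hv : v ≠ 0 := by rintro rfl; simp at hf
  rw [h0]
  split_ifs with h
  · have h1 : (LinearMap.ker f ⊓ X) ⊔ K ∙ v = X := by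
      apply le_antisymm
      · exact sup_le inf_le_right ((Submodule.span_singleton_le_iff_mem _ _).2 h)
      · intro x hx
        refine Submodule.mem_sup.2 ⟨x - f x • v, ⟨by simp [hf], X.sub_mem hx (X.smul_mem _ h)⟩,
          f x • v, Submodule.smul_mem _ _ (Submodule.mem_span_singleton_self v), by simp⟩
    have h2 : (LinearMap.ker f ⊓ X) ⊓ K ∙ v = ⊥ := by
      rw [eq_bot_iff]
      rintro x ⟨⟨hx, -⟩, hx'⟩
      obtain ⟨c, rfl⟩ := Submodule.mem_span_singleton.1 hx'
      have : c = 0 := by simpa [hf] using hx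
      simp [this]
    have := Submodule.finrank_sup_add_finrank_inf_eq (LinearMap.ker f ⊓ X) (K ∙ v)
    rw [h1, h2, finrank_bot, finrank_span_singleton hv] at this
    omega
  · rw [inf_eq_right.2 (hX.resolve_left h), add_zero]

/-- Any nonzero v in the smallest nonzero B i and the smallest C j meeting it will do. The members C
k that avoid v form a chain, so v also avoids their supremum, and a functional with value 1 at v
kills them all. Every member of either chain thus contains v or, being zero or avoiding v, lies in
ker f, which makes both chains split along ker f ⊕ Kv. -/
theorem exists_splitting_vector {ι κ : Type*} {W : Type*} [AddCommGroup W] [Module K W]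
    (B : ι → Submodule K W) (C : κ → Submodule K W)
    (hC : ∀ i j, C i ≤ C j ∨ C j ≤ C i) (i : ι) (j : κ)
    (hi : ∀ k, B k ≠ ⊥ → B i ≤ B k) (hj0 : B i ⊓ C j ≠ ⊥)
    (hj : ∀ k, B i ⊓ C k ≠ ⊥ → C j ≤ C k) :
    ∃ (v : W) (f : Dual K W), f v = 1 ∧ (∀ k, v ∈ B k ↔ B k ≠ ⊥) ∧
      (∀ k, v ∈ C k ↔ B i ⊓ C k ≠ ⊥) ∧ ∀ k, v ∉ C k → C k ≤ LinearMap.ker f := by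
  obtain ⟨v, hv, hv0⟩ := Submodule.exists_mem_ne_zero_of_ne_bot hj0
  have hr : v ∉ ⨆ k : {k // v ∉ C k}, C k := by
    intro h
    by_cases hne : Nonempty {k // v ∉ C k}
    · rw [Submodule.mem_iSup_of_directed] at h
      · obtain ⟨k, hk⟩ := h
        exact k.2 hk
      · intro a b
        rcases hC a b with h | h
        · exact ⟨b, h, le_rfl⟩
        · exact ⟨a, le_rfl, h⟩
    · rw [not_nonempty_iff] at hne
      rw [iSup_of_empty] at h
      exact hv0 ((Submodule.mem_bot K).1 h)
  obtain ⟨f, hf, hle⟩ := Submodule.exists_le_ker_of_notMem hr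
  refine ⟨v, (f v)⁻¹ • f, by simp [hf], fun k => ⟨?_, fun h => hi k h hv.1⟩,
    fun k => ⟨?_, fun h => hj k h hv.2⟩, fun k hk x hx => ?_⟩
  · rintro h h'
    rw [h'] at h
    exact hv0 ((Submodule.mem_bot K).1 h)
  · rintro h h'
    exact hv0 ((Submodule.mem_bot K).1 (h' ▸ (⟨hv.1, h⟩ : v ∈ B i ⊓ C k)))
  · have : f x = 0 := hle (le_iSup (fun k : {k // v ∉ C k} => C k) ⟨k, hk⟩ hx)
    simp [this]

theorem map_splitEquiv_le {W : Type*} {W' : Type*} [AddCommGroup W] [Module K W]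
    [AddCommGroup W'] [Module K W'] {f : Dual K W} {v : W} (hf : f v = 1)
    {f' : Dual K W'} {v' : W'} (hf' : f' v' = 1)
    (h : LinearMap.ker f ≃ₗ[K] LinearMap.ker f') {X : Submodule K W} {X' : Submodule K W'}
    (hX : v ∈ X ∨ X ≤ LinearMap.ker f) (hv : v ∈ X → v' ∈ X')
    (hh : (X.comap (LinearMap.ker f).subtype).map (h : LinearMap.ker f →ₗ[K] LinearMap.ker f') =
      X'.comap (LinearMap.ker f').subtype) :
    X.map (((splitEquiv f v hf).trans ((h.prodCongr (LinearEquiv.refl K K)).trans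
      (splitEquiv f' v' hf').symm) : W ≃ₗ[K] W') : W →ₗ[K] W') ≤ X' := by
  rintro _ ⟨x, hx, rfl⟩
  have key : ((h ⟨x - f x • v, by simp [hf]⟩ : LinearMap.ker f') : W') + f x • v' ∈ X' := by
    by_cases hvX : v ∈ X
    · refine X'.add_mem ?_ (X'.smul_mem _ (hv hvX))
      have : h ⟨x - f x • v, by simp [hf]⟩ ∈ X'.comap (LinearMap.ker f').subtype := by
        rw [← hh]
        exact ⟨_, X.sub_mem hx (X.smul_mem _ hvX), rfl⟩
      exact this
    · have hfx : f x = 0 := hX.resolve_left hvX hx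
      have : h ⟨x - f x • v, by simp [hf]⟩ ∈ X'.comap (LinearMap.ker f').subtype := by
        rw [← hh]
        refine ⟨_, ?_, rfl⟩
        simpa [hfx] using hx
      simpa [hfx] using this
  exact key

theorem exists_minimizer {σ : Type*} (s : Set σ) (d : σ → ℕ) (hs : s.Nonempty) :
    ∃ i ∈ s, ∀ k ∈ s, d i ≤ d k := by
  obtain ⟨a, ha, hm⟩ := (measure d).wf.has_min s hs
  exact ⟨a, ha, fun k hk => not_lt.1 (hm k hk)⟩

theorem le_of_comparable {U : Type*} [AddCommGroup U] [Module K U] [FiniteDimensional K U]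
    {X Y : Submodule K U} (h : X ≤ Y ∨ Y ≤ X) (hd : finrank K X ≤ finrank K Y) : X ≤ Y := by
  rcases h with h | h
  · exact h
  · exact (Submodule.eq_of_le_of_finrank_le h hd).ge

theorem option_elim_top_comparable {U σ : Type*} [AddCommGroup U] [Module K U]
    {D : σ → Submodule K U} (h : ∀ i j, D i ≤ D j ∨ D j ≤ D i) (a b : Option σ) :
    a.elim ⊤ D ≤ b.elim ⊤ D ∨ b.elim ⊤ D ≤ a.elim ⊤ D := by
  rcases a with _ | a <;> rcases b with _ | b
  · simp
  · simp
  · simp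
  · simpa using h a b

/-- Induction on the dimension: `exists_splitting_vector` splits off a line adapted to both chains,
on each side, and the hyperplanes that remain carry chains of the same kind. Members equal to the
whole space are required so that the dimensions of single members are among the dimensions of
intersections. -/
theorem exists_equiv_of_chains_aux {ι κ : Type*} (n : ℕ) :
    ∀ {W : Type u} {W' : Type v} [AddCommGroup W] [Module K W] [FiniteDimensional K W]
      [AddCommGroup W'] [Module K W'] [FiniteDimensional K W']
      (B : ι → Submodule K W) (C : κ → Submodule K W)
      (B' : ι → Submodule K W') (C' : κ → Submodule K W'), finrank K W = n →
      (∀ i j, B i ≤ B j ∨ B j ≤ B i) → (∀ i j, C i ≤ C j ∨ C j ≤ C i) →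
      (∀ i j, B' i ≤ B' j ∨ B' j ≤ B' i) → (∀ i j, C' i ≤ C' j ∨ C' j ≤ C' i) →
      (∃ i, B i = ⊤ ∧ B' i = ⊤) → (∃ j, C j = ⊤ ∧ C' j = ⊤) →
      (∀ i j, finrank K ↥(B i ⊓ C j) = finrank K ↥(B' i ⊓ C' j)) →
      ∃ g : W ≃ₗ[K] W', (∀ i, (B i).map (g : W →ₗ[K] W') = B' i) ∧
        ∀ j, (C j).map (g : W →ₗ[K] W') = C' j := by
  classical
  induction n with
  | zero =>
    intro W W' _ _ _ _ _ _ B C B' C' hn _ _ _ _ hBt hCt hd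
    obtain ⟨i, hi, hi'⟩ := hBt
    obtain ⟨j, hj, hj'⟩ := hCt
    have hn' : finrank K W' = 0 := by
      have := hd i j
      rw [hi, hi', hj, hj', inf_top_eq, inf_top_eq, finrank_top, finrank_top] at this
      omega
    have := finrank_zero_iff.1 hn
    have := finrank_zero_iff.1 hn'
    exact ⟨LinearEquiv.ofFinrankEq W W' (hn.trans hn'.symm), fun i => Subsingleton.elim _ _,
      fun i => Subsingleton.elim _ _⟩
  | succ n ih =>
    intro W W' _ _ _ _ _ _ B C B' C' hn hB hC hB' hC' hBt hCt hd
    obtain ⟨i₀, hi₀, hi₀'⟩ := hBt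
    obtain ⟨j₀, hj₀, hj₀'⟩ := hCt
    have hdB : ∀ i, finrank K (B i) = finrank K (B' i) := fun i => by
      have := hd i j₀
      rwa [hj₀, hj₀', inf_top_eq, inf_top_eq] at this
    have hdC : ∀ j, finrank K (C j) = finrank K (C' j) := fun j => by
      have := hd i₀ j
      rwa [hi₀, hi₀', top_inf_eq, top_inf_eq] at this
    have hbot : ∀ i, B i = ⊥ ↔ B' i = ⊥ := fun i => by
      rw [← Submodule.finrank_eq_zero (R := K), ← Submodule.finrank_eq_zero (R := K), hdB]
    have hbot2 : ∀ i j, B i ⊓ C j = ⊥ ↔ B' i ⊓ C' j = ⊥ := fun i j => by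
      rw [← Submodule.finrank_eq_zero (R := K), ← Submodule.finrank_eq_zero (R := K), hd]
    have hWtop : (⊤ : Submodule K W) ≠ ⊥ := by
      intro h
      have := congrArg (fun X : Submodule K W => finrank K X) h
      simp [hn] at this
    -- The choice of i and j depends on dimensions only, so the same indices serve for the chains in
    -- W'.
    obtain ⟨i, hi0, him⟩ := exists_minimizer {k | B k ≠ ⊥} (fun k => finrank K (B k))
      ⟨i₀, by change B i₀ ≠ ⊥; rw [hi₀]; exact hWtop⟩
    obtain ⟨j, hj0, hjm⟩ := exists_minimizer {k | B i ⊓ C k ≠ ⊥} (fun k => finrank K (C k))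
      ⟨j₀, by change B i ⊓ C j₀ ≠ ⊥; rw [hj₀, inf_top_eq]; exact hi0⟩
    obtain ⟨v, f, hf, hvB, hvC, hker⟩ := exists_splitting_vector B C hC i j
      (fun k hk => le_of_comparable (hB _ _) (him k hk)) hj0 (fun k hk => le_of_comparable (hC _ _) (hjm k hk))
    obtain ⟨v', f', hf', hvB', hvC', hker'⟩ := exists_splitting_vector B' C' hC' i j
      (fun k hk => le_of_comparable (hB' _ _) (by
        rw [← hdB, ← hdB]; exact him k (fun h => hk ((hbot k).1 h))))
      (fun h => hj0 ((hbot2 i j).2 h)) (fun k hk => le_of_comparable (hC' _ _) (by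
        rw [← hdC, ← hdC]; exact hjm k (fun h => hk ((hbot2 i k).1 h))))
    have eB : ∀ k, v ∈ B k ↔ v' ∈ B' k := fun k => by rw [hvB, hvB', Ne, Ne, hbot]
    have eC : ∀ k, v ∈ C k ↔ v' ∈ C' k := fun k => by rw [hvC, hvC', Ne, Ne, hbot2]
    have cB : ∀ k, v ∈ B k ∨ B k ≤ LinearMap.ker f := fun k => by
      by_cases h : B k = ⊥
      · right; rw [h]; exact bot_le
      · left; exact (hvB k).2 h
    have cB' : ∀ k, v' ∈ B' k ∨ B' k ≤ LinearMap.ker f' := fun k => by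
      by_cases h : B' k = ⊥
      · right; rw [h]; exact bot_le
      · left; exact (hvB' k).2 h
    have cC : ∀ k, v ∈ C k ∨ C k ≤ LinearMap.ker f := fun k => by
      by_cases h : v ∈ C k
      exacts [Or.inl h, Or.inr (hker k h)]
    have cC' : ∀ k, v' ∈ C' k ∨ C' k ≤ LinearMap.ker f' := fun k => by
      by_cases h : v' ∈ C' k
      exacts [Or.inl h, Or.inr (hker' k h)]
    have hfin : finrank K (LinearMap.ker f) = n := by
      have := (splitEquiv f v hf).finrank_eq
      rw [finrank_prod, finrank_self, hn] at this
      omega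
    obtain ⟨h, hgB, hgC⟩ := ih (fun k => (B k).comap (LinearMap.ker f).subtype)
      (fun k => (C k).comap (LinearMap.ker f).subtype)
      (fun k => (B' k).comap (LinearMap.ker f').subtype)
      (fun k => (C' k).comap (LinearMap.ker f').subtype) hfin
      (fun a b => (hB a b).imp (Submodule.comap_mono ·) (Submodule.comap_mono ·))
      (fun a b => (hC a b).imp (Submodule.comap_mono ·) (Submodule.comap_mono ·))
      (fun a b => (hB' a b).imp (Submodule.comap_mono ·) (Submodule.comap_mono ·))
      (fun a b => (hC' a b).imp (Submodule.comap_mono ·) (Submodule.comap_mono ·))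
      ⟨i₀, by simp [hi₀], by simp [hi₀']⟩ ⟨j₀, by simp [hj₀], by simp [hj₀']⟩
      -- Passing to the kernel lowers the dimension of an intersection by one exactly if it contains
      -- v, and v, v' lie in corresponding members.
      (fun a b => by
        have c1 : v ∈ B a ⊓ C b ∨ B a ⊓ C b ≤ LinearMap.ker f := by
          rcases cB a with h | h
          · rcases cC b with h' | h'
            exacts [Or.inl ⟨h, h'⟩, Or.inr (inf_le_right.trans h')]
          · exact Or.inr (inf_le_left.trans h)
        have c2 : v' ∈ B' a ⊓ C' b ∨ B' a ⊓ C' b ≤ LinearMap.ker f' := by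
          rcases cB' a with h | h
          · rcases cC' b with h' | h'
            exacts [Or.inl ⟨h, h'⟩, Or.inr (inf_le_right.trans h')]
          · exact Or.inr (inf_le_left.trans h)
        have e1 := finrank_eq_comap_ker_add hf c1
        have e2 := finrank_eq_comap_ker_add hf' c2
        have e3 : v ∈ B a ⊓ C b ↔ v' ∈ B' a ⊓ C' b := and_congr (eB a) (eC b)
        rw [hd, e2] at e1
        simp only [e3] at e1
        exact (Nat.add_right_cancel e1).symm)
    refine ⟨(splitEquiv f v hf).trans ((h.prodCongr (LinearEquiv.refl K K)).trans
      (splitEquiv f' v' hf').symm), fun k => ?_, fun k => ?_⟩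
    · refine Submodule.eq_of_le_of_finrank_eq
        (map_splitEquiv_le hf hf' h (cB k) (eB k).1 (hgB k)) ?_
      rw [LinearEquiv.finrank_map_eq, hdB]
    · refine Submodule.eq_of_le_of_finrank_eq
        (map_splitEquiv_le hf hf' h (cC k) (eC k).1 (hgC k)) ?_
      rw [LinearEquiv.finrank_map_eq, hdC]

/-- Two pairs of chains in finite dimensional spaces are conjugate as soon as the dimensions of
their members and of the intersections of their members agree. -/
theorem exists_equiv_of_chains {ι κ : Type*} {W : Type u} {W' : Type v} [AddCommGroup W]
    [Module K W] [FiniteDimensional K W] [AddCommGroup W'] [Module K W'] [FiniteDimensional K W']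
    (B : ι → Submodule K W) (C : κ → Submodule K W)
    (B' : ι → Submodule K W') (C' : κ → Submodule K W') (hW : finrank K W = finrank K W')
    (hB : ∀ i j, B i ≤ B j ∨ B j ≤ B i) (hC : ∀ i j, C i ≤ C j ∨ C j ≤ C i)
    (hB' : ∀ i j, B' i ≤ B' j ∨ B' j ≤ B' i) (hC' : ∀ i j, C' i ≤ C' j ∨ C' j ≤ C' i)
    (hdB : ∀ i, finrank K (B i) = finrank K (B' i)) (hdC : ∀ j, finrank K (C j) = finrank K (C' j))
    (hd : ∀ i j, finrank K ↥(B i ⊓ C j) = finrank K ↥(B' i ⊓ C' j)) :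
    ∃ g : W ≃ₗ[K] W', (∀ i, (B i).map (g : W →ₗ[K] W') = B' i) ∧
      ∀ j, (C j).map (g : W →ₗ[K] W') = C' j := by
  -- The index `none` adjoins the whole space to each chain.
  obtain ⟨g, h1, h2⟩ := exists_equiv_of_chains_aux (finrank K W) (fun a : Option ι => a.elim ⊤ B)
    (fun a : Option κ => a.elim ⊤ C) (fun a : Option ι => a.elim ⊤ B')
    (fun a : Option κ => a.elim ⊤ C') rfl (option_elim_top_comparable hB)
    (option_elim_top_comparable hC) (option_elim_top_comparable hB')
    (option_elim_top_comparable hC')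
    ⟨none, rfl, rfl⟩ ⟨none, rfl, rfl⟩ (by
      rintro (_ | a) (_ | b)
      · change finrank K ↥((⊤ : Submodule K W) ⊓ ⊤) = finrank K ↥((⊤ : Submodule K W') ⊓ ⊤)
        rw [inf_top_eq, inf_top_eq, finrank_top, finrank_top, hW]
      · change finrank K ↥(⊤ ⊓ C b) = finrank K ↥(⊤ ⊓ C' b)
        rw [top_inf_eq, top_inf_eq, hdC]
      · change finrank K ↥(B a ⊓ ⊤) = finrank K ↥(B' a ⊓ ⊤)
        rw [inf_top_eq, inf_top_eq, hdB]
      · exact hd a b)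
  exact ⟨g, fun i => h1 (some i), fun j => h2 (some j)⟩

end Chains

/-! ### Determinants of quaternionic maps, and real points of pencils -/

/-- If v is an eigenvector of g for c, then σv is one for the conjugate of c. They span an invariant
plane on which g has determinant |c|², and induction applies to the quotient, whose dimension is
smaller by 2. -/
theorem exists_det_eq_ofReal_nonneg_aux (n : ℕ) : ∀ {W : Type*} [AddCommGroup W] [Module ℂ W]
    [FiniteDimensional ℂ W] (σ : W →ₛₗ[starRingEnd ℂ] W) (g : W →ₗ[ℂ] W), finrank ℂ W = n →
    (∀ w, σ (σ w) = -w) → (∀ w, g (σ w) = σ (g w)) →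
    ∃ r : ℝ, 0 ≤ r ∧ LinearMap.det g = r := by
  induction n using Nat.strong_induction_on with
  | _ n ih =>
    intro W _ _ _ σ g hn hσ hg
    rcases Nat.eq_zero_or_pos n with rfl | hpos
    · exact ⟨1, zero_le_one, by rw [LinearMap.det_eq_one_of_finrank_eq_zero hn]; simp⟩
    have : Nontrivial W := nontrivial_of_finrank_pos (R := ℂ) (hn ▸ hpos)
    obtain ⟨c, hc⟩ := Module.End.exists_eigenvalue g
    obtain ⟨v, hv⟩ := hc.exists_hasEigenvector
    have hgv : g v = c • v := hv.apply_eq_smul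
    have hv0 : v ≠ 0 := hv.2
    have hgσ : g (σ v) = (starRingEnd ℂ c) • σ v := by rw [hg, hgv, map_smulₛₗ]
    have hli : LinearIndependent ℂ ![v, σ v] := by
      rw [LinearIndependent.pair_iff]
      intro s t h
      have h' : (starRingEnd ℂ s) • σ v - (starRingEnd ℂ t) • v = 0 := by
        have := congrArg σ h
        simpa [map_smulₛₗ, hσ, sub_eq_add_neg] using this
      -- Eliminating σv from the relation and its image under σ leaves (|s|² + |t|²)v = 0.
      have h2 : (s * starRingEnd ℂ s + t * starRingEnd ℂ t) • v = 0 := by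
        have h3 : (starRingEnd ℂ s) • (s • v + t • σ v) -
            t • ((starRingEnd ℂ s) • σ v - (starRingEnd ℂ t) • v) = 0 := by rw [h, h']; simp
        rw [← h3]
        module
      have h4 := (smul_eq_zero.1 h2).resolve_right hv0
      rw [Complex.mul_conj, Complex.mul_conj, ← Complex.ofReal_add, Complex.ofReal_eq_zero] at h4
      have := Complex.normSq_nonneg s
      have := Complex.normSq_nonneg t
      exact ⟨Complex.normSq_eq_zero.1 (by linarith), Complex.normSq_eq_zero.1 (by linarith)⟩
    let P : Submodule ℂ W := Submodule.span ℂ (Set.range ![v, σ v])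
    have hvP : v ∈ P := Submodule.subset_span ⟨0, rfl⟩
    have hσvP : σ v ∈ P := Submodule.subset_span ⟨1, rfl⟩
    have hPg : P ≤ P.comap g := by
      refine Submodule.span_le.2 ?_
      rintro _ ⟨i, rfl⟩
      fin_cases i
      · change g v ∈ P
        rw [hgv]; exact P.smul_mem _ hvP
      · change g (σ v) ∈ P
        rw [hgσ]; exact P.smul_mem _ hσvP
    have hPσ : P ≤ P.comap σ := by
      refine Submodule.span_le.2 ?_
      rintro _ ⟨i, rfl⟩
      fin_cases i
      · exact hσvP
      · change σ (σ v) ∈ P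
        rw [hσ]; exact P.neg_mem hvP
    let b : Basis (Fin 2) ℂ P := Basis.span hli
    have hb0 : b 0 = ⟨v, hvP⟩ := Basis.span_apply hli _
    have hb1 : b 1 = ⟨σ v, hσvP⟩ := Basis.span_apply hli _
    have hdP : LinearMap.det (g.restrict hPg) = c * starRingEnd ℂ c := by
      have e0 : g.restrict hPg (b 0) = c • b 0 := by
        rw [hb0]; exact Subtype.ext hgv
      have e1 : g.restrict hPg (b 1) = (starRingEnd ℂ c) • b 1 := by
        rw [hb1]; exact Subtype.ext hgσ
      rw [← LinearMap.det_toMatrix b, Matrix.det_fin_two]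
      simp [LinearMap.toMatrix_apply, e0, e1]
    have hfin : finrank ℂ (W ⧸ P) < n := by
      have h1 := P.finrank_quotient_add_finrank
      have h2 : finrank ℂ P = 2 := by rw [finrank_span_eq_card hli]; simp
      omega
    obtain ⟨r, hr, hdQ⟩ := ih _ hfin (P.mapQ P σ hPσ) (P.mapQ P g hPg) rfl
      (fun w => by
        obtain ⟨w, rfl⟩ := P.mkQ_surjective w
        simp [hσ])
      (fun w => by
        obtain ⟨w, rfl⟩ := P.mkQ_surjective w
        simp [hg])
    refine ⟨Complex.normSq c * r, mul_nonneg (Complex.normSq_nonneg c) hr, ?_⟩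
    rw [LinearMap.det_eq_det_mul_det P g hPg, hdP, hdQ, Complex.mul_conj, Complex.ofReal_mul]

/-- The determinant of a map that commutes with a quaternionic structure is real and
nonnegative. -/
theorem exists_det_eq_ofReal_nonneg {W : Type*} [AddCommGroup W] [Module ℂ W]
    [FiniteDimensional ℂ W] (σ : W →ₛₗ[starRingEnd ℂ] W) (g : W →ₗ[ℂ] W)
    (hσ : ∀ w, σ (σ w) = -w) (hg : ∀ w, g (σ w) = σ (g w)) :
    ∃ r : ℝ, 0 ≤ r ∧ LinearMap.det g = r :=
  exists_det_eq_ofReal_nonneg_aux _ σ g rfl hσ hg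

/-- The combination is singular only if −a/ā is an eigenvalue of g⁻¹h. There are finitely many of
these, while a = 1 + ir gives infinitely many ratios. -/
theorem exists_injective_smul_add_conj_smul {W : Type*} [AddCommGroup W] [Module ℂ W]
    [FiniteDimensional ℂ W] (g : W ≃ₗ[ℂ] W) (h : W →ₗ[ℂ] W) :
    ∃ a : ℂ, Function.Injective (a • (g : W →ₗ[ℂ] W) + (starRingEnd ℂ a) • h) := by
  let k : Module.End ℂ W := (g.symm : W →ₗ[ℂ] W) ∘ₗ h
  let z : ℝ → ℂ := fun r => ⟨1, r⟩
  have hz : ∀ r, starRingEnd ℂ (z r) ≠ 0 := fun r h0 => by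
    have := congrArg Complex.re h0
    simp [z] at this
  let F : ℝ → ℂ := fun r => -(z r / starRingEnd ℂ (z r))
  have hF : Function.Injective F := by
    intro r s hrs
    have h1 := neg_injective hrs
    rw [div_eq_div_iff (hz r) (hz s)] at h1
    have := congrArg Complex.im h1
    simp [z] at this
    linarith
  have hfin : (F ⁻¹' {μ | k.HasEigenvalue μ}).Finite :=
    (Module.End.finite_hasEigenvalue k).preimage hF.injOn
  obtain ⟨r, hr⟩ := hfin.exists_notMem
  refine ⟨z r, (injective_iff_map_eq_zero _).2 fun w hw => ?_⟩
  by_contra hw0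
  apply hr
  refine Module.End.hasEigenvalue_of_hasEigenvector (x := w)
    ⟨Module.End.mem_eigenspace_iff.2 ?_, hw0⟩
  apply g.injective
  have e1 : g (k w) = h w := by simp [k]
  rw [e1, map_smul]
  have e2 : z r • g w + (starRingEnd ℂ (z r)) • h w = 0 := hw
  rw [← smul_right_injective W (hz r) |>.eq_iff]
  simp only [F]
  rw [smul_smul, mul_neg, mul_div_cancel₀ _ (hz r), neg_smul]
  exact eq_neg_of_add_eq_zero_right e2

/-! ### Openness of rank conditions -/

/-- V carries no topology, so continuity is tested on functionals. At an independent family, a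
linear left inverse F to the coordinates turns independence nearby into the nonvanishing of a
continuous determinant. -/
theorem isOpen_setOf_linearIndependent_of_dual {X V κ : Type*} [TopologicalSpace X]
    [AddCommGroup V] [Module ℂ V] [Finite κ] (v : X → κ → V)
    (hv : ∀ (f : Dual ℂ V) (i : κ), Continuous fun x => f (v x i)) :
    IsOpen {x | LinearIndependent ℂ (v x)} := by
  classical
  have := Fintype.ofFinite κ
  rw [isOpen_iff_mem_nhds]
  intro x₀ hx₀
  have hx₀ : LinearIndependent ℂ (v x₀) := hx₀
  obtain ⟨F, hF⟩ : ∃ F : V →ₗ[ℂ] (κ → ℂ), ∀ i, F (v x₀ i) = Pi.single i 1 := by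
    obtain ⟨F, hF⟩ := LinearMap.exists_leftInverse_of_injective
      (Fintype.linearCombination ℂ (v x₀))
      (LinearMap.ker_eq_bot.2 (linearIndependent_iff_injective_fintypeLinearCombination.1 hx₀))
    refine ⟨F, fun i => ?_⟩
    have := LinearMap.congr_fun hF (Pi.single i 1)
    simpa [Fintype.linearCombination_apply, Pi.single_apply] using this
  let D : X → ℂ := fun x => (Matrix.of fun i j => F (v x i) j).det
  have hD : Continuous D := by
    refine Continuous.matrix_det (continuous_matrix fun i j => ?_)
    exact hv ((LinearMap.proj j : (κ → ℂ) →ₗ[ℂ] ℂ) ∘ₗ F) i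
  have hD0 : D x₀ ≠ 0 := by
    have : (Matrix.of fun i j => F (v x₀ i) j) = 1 := by
      ext i j
      simp [hF, Matrix.one_apply, Pi.single_apply, eq_comm]
    simp [D, this]
  filter_upwards [hD.continuousAt.eventually_ne hD0] with x hx
  have h1 : LinearIndependent ℂ fun i => F (v x i) :=
    Matrix.linearIndependent_rows_of_det_ne_zero (A := Matrix.of fun i j => F (v x i) j) hx
  exact LinearIndependent.of_comp F h1

theorem isOpen_setOf_le_finrank_span {X V κ : Type*} [TopologicalSpace X]
    [AddCommGroup V] [Module ℂ V] [Finite κ] (v : X → κ → V)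
    (hv : ∀ (f : Dual ℂ V) (i : κ), Continuous fun x => f (v x i)) (k : ℕ) :
    IsOpen {x | k ≤ finrank ℂ (Submodule.span ℂ (Set.range (v x)))} := by
  classical
  have := Fintype.ofFinite κ
  -- The rank is at least k if and only if some subfamily with at least k members is independent;
  -- there are finitely many subfamilies.
  have : {x | k ≤ finrank ℂ (Submodule.span ℂ (Set.range (v x)))} =
      ⋃ s ∈ {s : Finset κ | k ≤ s.card}, {x | LinearIndependent ℂ fun i : s => v x i} := by
    ext x
    have hfd : FiniteDimensional ℂ (Submodule.span ℂ (Set.range (v x))) :=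
      FiniteDimensional.span_of_finite ℂ (Set.finite_range _)
    refine ⟨fun (hx : k ≤ _) => ?_, fun hx => ?_⟩
    · obtain ⟨ι, a, ha, hspan, hli⟩ := exists_linearIndependent' ℂ (v x)
      have := Fintype.ofInjective a ha
      rw [← hspan, finrank_span_eq_card hli] at hx
      simp only [Set.mem_iUnion]
      refine ⟨Finset.univ.image a, ?_, ?_⟩
      · change k ≤ _
        rwa [Finset.card_image_of_injective _ ha, Finset.card_univ]
      · have h2 : LinearIndepOn ℂ (v x) (Set.range a) :=
          (linearIndepOn_range_iff ha (v x)).2 hli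
        have h3 : ((Finset.univ.image a : Finset κ) : Set κ) = Set.range a := by simp
        rw [← h3] at h2
        exact h2
    · simp only [Set.mem_iUnion] at hx
      obtain ⟨s, hs, hli⟩ := hx
      have hs : k ≤ s.card := hs
      have hli : LinearIndependent ℂ fun i : s => v x i := hli
      have h1 := finrank_span_eq_card hli
      rw [Fintype.card_coe] at h1
      change k ≤ _
      rw [← h1] at hs
      refine hs.trans (Submodule.finrank_mono (Submodule.span_mono ?_))
      rintro _ ⟨i, rfl⟩
      exact ⟨i, rfl⟩
  rw [this]
  exact isOpen_biUnion fun s _ =>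
    isOpen_setOf_linearIndependent_of_dual (fun x (i : s) => v x i) fun f i => hv f i

/-! ### Subspaces commensurable along a finite dimensional subspace -/

section

variable {V : Type*} [AddCommGroup V] [Module ℂ V]

/-- `X` and `Y` differ only inside `U`. -/
def IsComm (U X Y : Submodule ℂ V) : Prop :=
  X ≤ Y ⊔ U ∧ Y ≤ X ⊔ U ∧ finrank ℂ ↥(X ⊓ U) = finrank ℂ ↥(Y ⊓ U)

theorem IsComm.symm {U X Y : Submodule ℂ V} (h : IsComm U X Y) : IsComm U Y X :=
  ⟨h.2.1, h.1, h.2.2.symm⟩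

theorem IsComm.sup_eq {U X Y : Submodule ℂ V} (h : IsComm U X Y) : X ⊔ U = Y ⊔ U :=
  le_antisymm (sup_le h.1 le_sup_right) (sup_le h.2.1 le_sup_right)

theorem IsComm.trans {U X Y Z : Submodule ℂ V} (h : IsComm U X Y) (h' : IsComm U Y Z) :
    IsComm U X Z :=
  ⟨h'.sup_eq ▸ h.1, h.sup_eq ▸ h'.2.1, h.2.2.trans h'.2.2⟩

/-- By the modular law, dim(Z ∩ U') + dim U = dim((Z + U) ∩ U') + dim(Z ∩ U), and the right side is
the same for X and Y. -/
theorem IsComm.mono {U U' X Y : Submodule ℂ V} (h : IsComm U X Y) (hU : U ≤ U')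
    [FiniteDimensional ℂ U'] : IsComm U' X Y := by
  have : FiniteDimensional ℂ U := Submodule.finiteDimensional_of_le hU
  refine ⟨h.1.trans (sup_le_sup_left hU _), h.2.1.trans (sup_le_sup_left hU _), ?_⟩
  have key : ∀ Z : Submodule ℂ V, finrank ℂ ↥(Z ⊓ U') + finrank ℂ U =
      finrank ℂ ↥((Z ⊔ U) ⊓ U') + finrank ℂ ↥(Z ⊓ U) := fun Z => by
    have e1 : Z ⊓ U' ⊔ U = (Z ⊔ U) ⊓ U' := by
      rw [sup_comm, ← sup_inf_assoc_of_le Z hU, sup_comm U Z]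
    have e2 : Z ⊓ U' ⊓ U = Z ⊓ U := by rw [inf_assoc, inf_eq_right.2 hU]
    have := Submodule.finrank_sup_add_finrank_inf_eq (Z ⊓ U') U
    rw [e1, e2] at this
    exact this.symm
  have h1 := key X
  have h2 := key Y
  rw [h.sup_eq, h.2.2] at h1
  omega

/-- The substitute for comparing dimensions when they are infinite: below, it upgrades inclusions
between members of flags to equalities. -/
theorem IsComm.eq_of_le {U X Y : Submodule ℂ V} (h : IsComm U X Y) [FiniteDimensional ℂ U]
    (hXY : X ≤ Y) : X = Y := by
  have h1 : X ⊓ U = Y ⊓ U :=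
    Submodule.eq_of_le_of_finrank_eq (inf_le_inf_right U hXY) h.2.2
  exact eq_of_le_of_inf_le_of_sup_le hXY h1.ge h.sup_eq.ge

end

variable {V : Type*} [AddCommGroup V] [Module ℂ V]

theorem basis_induction (E : Basis ℕ ℂ V) {p : V → Prop} (v : V) (zero : p 0) (coe : ∀ j, p (E j))
    (add : ∀ v w, p v → p w → p (v + w)) (smul : ∀ (c : ℂ) v, p v → p (c • v)) : p v := by
  have hv : v ∈ Submodule.span ℂ (Set.range E) := E.span_eq ▸ Submodule.mem_top
  induction hv using Submodule.span_induction with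
  | zero => exact zero
  | mem x hx => obtain ⟨j, rfl⟩ := hx; exact coe j
  | add v w _ _ hv hw => exact add v w hv hw
  | smul c v _ hv => exact smul c v hv

theorem finrank_map_of_injective {W W' : Type*} [AddCommGroup W] [Module ℂ W] [AddCommGroup W']
    [Module ℂ W'] {f : W →ₗ[ℂ] W'} (hf : Function.Injective f) (X : Submodule ℂ W) :
    finrank ℂ (X.map f) = finrank ℂ X :=
  (Submodule.equivMapOfInjective f hf X).finrank_eq.symm

/-! ### The first `m` coordinates -/

/-- The inclusion of `ℂ^m` into `V` as the span of `E 0, …, E (m - 1)`. -/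
noncomputable def emb (E : Basis ℕ ℂ V) (m : ℕ) : (Fin m → ℂ) →ₗ[ℂ] V :=
  Fintype.linearCombination ℂ fun i : Fin m => E i

/-- The first `m` coordinates. -/
noncomputable def coords (E : Basis ℕ ℂ V) (m : ℕ) : V →ₗ[ℂ] (Fin m → ℂ) :=
  LinearMap.pi fun i => E.coord i

/-- The projection of `V` to the span of `E 0, …, E (m - 1)` along the other basis vectors. -/
noncomputable def trunc (E : Basis ℕ ℂ V) (m : ℕ) : V →ₗ[ℂ] V := emb E m ∘ₗ coords E m

/-- The span of `E 0, …, E (m - 1)`. -/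
noncomputable def lo (E : Basis ℕ ℂ V) (m : ℕ) : Submodule ℂ V := LinearMap.range (emb E m)

/-- The span of `E m, E (m + 1), …`. -/
noncomputable def hi (E : Basis ℕ ℂ V) (m : ℕ) : Submodule ℂ V := LinearMap.ker (trunc E m)

/-- `X` is the sum of its intersections with `lo E m` and `hi E m`. -/
def IsSplit (E : Basis ℕ ℂ V) (m : ℕ) (X : Submodule ℂ V) : Prop := ∀ v ∈ X, trunc E m v ∈ X

section Coordinates

variable (E : Basis ℕ ℂ V) (m : ℕ)

instance finiteDimensional_lo : FiniteDimensional ℂ (lo E m) := by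
  unfold lo; infer_instance

@[simp] theorem coords_apply (v : V) (i : Fin m) : coords E m v i = E.repr v i := rfl

@[simp] theorem coords_emb (x : Fin m → ℂ) : coords E m (emb E m x) = x := by
  ext i
  simp [emb, Fintype.linearCombination_apply, Finsupp.single_apply, Fin.val_inj]

theorem emb_injective : Function.Injective (emb E m) :=
  Function.LeftInverse.injective (coords_emb E m)

theorem emb_coords (v : V) : emb E m (coords E m v) = trunc E m v := rfl

@[simp] theorem trunc_emb (x : Fin m → ℂ) : trunc E m (emb E m x) = emb E m x := by
  rw [← emb_coords, coords_emb]

@[simp] theorem trunc_trunc (v : V) : trunc E m (trunc E m v) = trunc E m v := by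
  rw [← emb_coords E m v, trunc_emb]

@[simp] theorem coords_trunc (v : V) : coords E m (trunc E m v) = coords E m v := by
  rw [← emb_coords E m v, coords_emb]

theorem emb_single (i : Fin m) : emb E m (Pi.single i 1) = E i := by
  simp [emb, Fintype.linearCombination_apply, Pi.single_apply]

variable {m}

theorem trunc_basis_lt {j : ℕ} (h : j < m) : trunc E m (E j) = E j := by
  have := trunc_emb E m (Pi.single ⟨j, h⟩ 1)
  rwa [emb_single] at this

theorem trunc_basis_ge {j : ℕ} (h : m ≤ j) : trunc E m (E j) = 0 := by
  have : coords E m (E j) = 0 := by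
    ext i
    have : j ≠ i := by omega
    simp [this]
  rw [← emb_coords, this, map_zero]

variable {E}

theorem mem_lo {v : V} : v ∈ lo E m ↔ trunc E m v = v := by
  constructor
  · rintro ⟨x, rfl⟩; simp
  · intro h; exact ⟨coords E m v, h⟩

theorem mem_hi {v : V} : v ∈ hi E m ↔ trunc E m v = 0 := Iff.rfl

theorem mem_hi_iff_coords {v : V} : v ∈ hi E m ↔ coords E m v = 0 := by
  rw [mem_hi, ← emb_coords, map_eq_zero_iff _ (emb_injective E m)]

theorem trunc_mem_lo (v : V) : trunc E m v ∈ lo E m := ⟨_, rfl⟩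

theorem sub_trunc_mem_hi (v : V) : v - trunc E m v ∈ hi E m := by simp [mem_hi]

theorem lo_mono {n : ℕ} (h : n ≤ m) : lo E n ≤ lo E m := by
  rintro _ ⟨x, rfl⟩
  simp only [emb, Fintype.linearCombination_apply]
  exact sum_mem fun i _ => Submodule.smul_mem _ _ (mem_lo.2 (trunc_basis_lt E (i.2.trans_le h)))

theorem exists_mem_lo (E : Basis ℕ ℂ V) (v : V) : ∃ m, v ∈ lo E m := by
  induction v using basis_induction E with
  | zero => exact ⟨0, zero_mem _⟩
  | coe j => exact ⟨j + 1, mem_lo.2 (trunc_basis_lt E (Nat.lt_succ_self j))⟩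
  | add v w hv hw =>
    obtain ⟨m, hv⟩ := hv
    obtain ⟨n, hw⟩ := hw
    exact ⟨max m n, add_mem (lo_mono (le_max_left _ _) hv) (lo_mono (le_max_right _ _) hw)⟩
  | smul c v hv => exact hv.imp fun m hv => Submodule.smul_mem _ _ hv

theorem exists_le_lo (E : Basis ℕ ℂ V) {s : Set V} (hs : s.Finite) : ∃ m, s ⊆ lo E m := by
  induction s, hs using Set.Finite.induction_on with
  | empty => exact ⟨0, Set.empty_subset _⟩
  | insert _ _ ih =>
    rename_i a s _ _
    obtain ⟨m, hm⟩ := ih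
    obtain ⟨n, hn⟩ := exists_mem_lo E a
    exact ⟨max m n, Set.insert_subset (lo_mono (le_max_right _ _) hn)
      (hm.trans (lo_mono (le_max_left _ _)))⟩

theorem exists_finiteDimensional_le_lo (E : Basis ℕ ℂ V) (U : Submodule ℂ V)
    [FiniteDimensional ℂ U] : ∃ m, U ≤ lo E m := by
  obtain ⟨s, hs⟩ := (Submodule.fg_iff_finiteDimensional U).2 inferInstance
  obtain ⟨m, hm⟩ := exists_le_lo E s.finite_toSet
  exact ⟨m, hs ▸ Submodule.span_le.2 hm⟩

theorem finrank_comap_emb (X : Submodule ℂ V) :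
    finrank ℂ (X.comap (emb E m)) = finrank ℂ ↥(X ⊓ lo E m) := by
  rw [← finrank_map_of_injective (emb_injective E m), Submodule.map_comap_eq, inf_comm]
  rfl

theorem mem_iff_of_isSplit {X : Submodule ℂ V} (hX : IsSplit E m X) (v : V) :
    v ∈ X ↔ coords E m v ∈ X.comap (emb E m) ∧ v - trunc E m v ∈ X :=
  ⟨fun h => ⟨hX v h, X.sub_mem h (hX v h)⟩, fun h => by
    simpa [emb_coords] using X.add_mem h.1 h.2⟩

theorem inf_hi_eq_of_sup_lo_eq {X Y : Submodule ℂ V} (hX : IsSplit E m X) (hY : IsSplit E m Y)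
    (h : X ⊔ lo E m = Y ⊔ lo E m) : X ⊓ hi E m = Y ⊓ hi E m := by
  have key : ∀ {X Y : Submodule ℂ V}, IsSplit E m Y → X ⊔ lo E m ≤ Y ⊔ lo E m →
      X ⊓ hi E m ≤ Y ⊓ hi E m := by
    rintro X Y hY h v ⟨hv, hv'⟩
    refine ⟨?_, hv'⟩
    obtain ⟨y, hy, l, hl, rfl⟩ := Submodule.mem_sup.1 (h (Submodule.mem_sup_left hv))
    have h1 : trunc E m y + l = 0 := by
      have h0 := mem_hi.1 hv'
      rwa [map_add, mem_lo.1 hl] at h0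
    rw [eq_neg_of_add_eq_zero_right h1]
    exact Y.add_mem hy (Y.neg_mem (hY y hy))
  exact le_antisymm (key hY h.le) (key hX h.ge)

end Coordinates

/-! ### The groups `SL(m; ℂ)` -/

section Groups

theorem matrixMap_apply (E : Basis ℕ ℂ V) {m : ℕ} (A : Matrix (Fin m) (Fin m) ℂ) (v : V) :
    matrixMap E m A v = emb E m (A.mulVec (coords E m v)) + (v - trunc E m v) := by
  suffices matrixMap E m A = emb E m ∘ₗ A.mulVecLin ∘ₗ coords E m + (LinearMap.id - trunc E m) by
    rw [this]; rfl
  refine E.ext fun j => ?_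
  rcases lt_or_ge j m with h | h
  · rw [show E j = E ((⟨j, h⟩ : Fin m) : ℕ) from rfl, matrixMap_lt]
    have h1 : coords E m (E ((⟨j, h⟩ : Fin m) : ℕ)) = Pi.single ⟨j, h⟩ 1 := by
      rw [← emb_single, coords_emb]
    simp only [LinearMap.add_apply, LinearMap.comp_apply, h1, Matrix.mulVecLin_apply,
      Matrix.mulVec_single_one, LinearMap.sub_apply, LinearMap.id_apply, trunc_basis_lt E h, sub_self,
      add_zero]
    simp [emb, Fintype.linearCombination_apply]
  · rw [matrixMap_ge E A h]
    have h1 : coords E m (E j) = 0 := mem_hi_iff_coords.1 (mem_hi.2 (trunc_basis_ge E h))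
    simp [h1, trunc_basis_ge E h]

theorem matrixMap_emb (E : Basis ℕ ℂ V) {m : ℕ} (A : Matrix (Fin m) (Fin m) ℂ) (x : Fin m → ℂ) :
    matrixMap E m A (emb E m x) = emb E m (A.mulVec x) := by
  simp [matrixMap_apply]

theorem coords_matrixMap (E : Basis ℕ ℂ V) {m : ℕ} (A : Matrix (Fin m) (Fin m) ℂ) (v : V) :
    coords E m (matrixMap E m A v) = A.mulVec (coords E m v) := by
  simp [matrixMap_apply]

theorem matrixMap_sub_trunc (E : Basis ℕ ℂ V) {m : ℕ} (A : Matrix (Fin m) (Fin m) ℂ) (v : V) :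
    matrixMap E m A v - trunc E m (matrixMap E m A v) = v - trunc E m v := by
  simp [matrixMap_apply]

theorem inv_apply_apply (g : LinearMap.GeneralLinearGroup ℂ V) (v : V) :
    (g⁻¹).val (g.val v) = v := by
  rw [← Module.End.mul_apply, Units.inv_mul, Module.End.one_apply]

theorem apply_inv_apply (g : LinearMap.GeneralLinearGroup ℂ V) (v : V) :
    g.val ((g⁻¹).val v) = v := by
  rw [← Module.End.mul_apply, Units.mul_inv, Module.End.one_apply]

theorem gl_injective (g : LinearMap.GeneralLinearGroup ℂ V) : Function.Injective g.val :=
  Function.LeftInverse.injective (inv_apply_apply g)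

theorem gl_surjective (g : LinearMap.GeneralLinearGroup ℂ V) : Function.Surjective g.val :=
  Function.RightInverse.surjective (apply_inv_apply g)

theorem mem_map_gl {g : LinearMap.GeneralLinearGroup ℂ V} {X : Submodule ℂ V} {v : V} :
    g.val v ∈ X.map g.val ↔ v ∈ X :=
  ⟨fun ⟨_, hw, h⟩ => gl_injective g h ▸ hw, fun h => ⟨v, h, rfl⟩⟩

theorem exists_slHom_range (E : Basis ℕ ℂ V) {g : LinearMap.GeneralLinearGroup ℂ V}
    (hg : g ∈ specialLinear E) : ∃ m₀, ∀ m ≥ m₀, ∃ A, g = slHom E m A := by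
  obtain ⟨n, hn⟩ := hg
  refine ⟨n, fun m hm => ?_⟩
  obtain ⟨A, hA⟩ := slHom_range_mono E hm hn
  exact ⟨A, hA.symm⟩

theorem slHom_mem (E : Basis ℕ ℂ V) {m : ℕ} (A : Matrix.SpecialLinearGroup (Fin m) ℂ) :
    slHom E m A ∈ specialLinear E := ⟨m, A, rfl⟩

theorem isComm_map_slHom (E : Basis ℕ ℂ V) {m : ℕ} (A : Matrix.SpecialLinearGroup (Fin m) ℂ)
    (X : Submodule ℂ V) : IsComm (lo E m) X (X.map (slHom E m A).val) := by
  have key : ∀ v, (slHom E m A).val v - v ∈ lo E m := fun v => by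
    have := matrixMap_sub_trunc E A.1 v
    rw [coe_slHom, sub_eq_iff_eq_add.1 this]
    have h2 : v - trunc E m v + trunc E m (matrixMap E m A.1 v) - v =
      trunc E m (matrixMap E m A.1 v) - trunc E m v := by abel
    rw [h2]
    exact sub_mem (trunc_mem_lo _) (trunc_mem_lo _)
  refine ⟨fun v hv => ?_, ?_, ?_⟩
  · refine Submodule.mem_sup.2 ⟨_, ⟨v, hv, rfl⟩, -((slHom E m A).val v - v), neg_mem (key v), ?_⟩
    abel
  · rintro _ ⟨v, hv, rfl⟩
    exact Submodule.mem_sup.2 ⟨v, hv, _, key v, by abel⟩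
  · rw [← finrank_map_of_injective (gl_injective (slHom E m A))]
    rw [Submodule.map_inf _ (gl_injective _)]
    have h3 : (lo E m).map (slHom E m A).val = lo E m := by
      refine Submodule.eq_of_le_of_finrank_eq ?_
        (finrank_map_of_injective (gl_injective (slHom E m A)) _)
      rintro _ ⟨v, hv, rfl⟩
      have := add_mem (key v) hv
      simpa using this
    rw [h3]

end Groups

/-! ### The conjugate linear map `τ` -/

section Tau

variable (E : Basis ℕ ℂ V) (𝔽 : ScalarCase)

/-- The scalar `τ²`. -/
def tauSign : ScalarCase → ℂ
  | .real => 1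
  | .quaternion => -1

theorem tauSign_mul_self : tauSign 𝔽 * tauSign 𝔽 = 1 := by cases 𝔽 <;> simp [tauSign]

theorem tauSign_ne_zero : tauSign 𝔽 ≠ 0 := by cases 𝔽 <;> simp [tauSign]

theorem conj_tauSign : starRingEnd ℂ (tauSign 𝔽) = tauSign 𝔽 := by cases 𝔽 <;> simp [tauSign]

@[simp] theorem tau_basis (j : ℕ) : tau E 𝔽 (E j) = tauBasis E 𝔽 j := by
  simp [tau]

@[simp] theorem tau_tau (v : V) : tau E 𝔽 (tau E 𝔽 v) = tauSign 𝔽 • v := by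
  induction v using basis_induction E with
  | zero => simp only [map_zero, smul_zero]
  | coe j =>
    cases 𝔽 with
    | real => simp [tauBasis, tauSign]
    | quaternion =>
      by_cases h : Even j
      · have h' : ¬ Even (j + 1) := by simpa [Nat.even_add_one] using h
        simp [tauBasis, tauSign, h, h']
      · have h' : Even (j - 1) := by
          rw [Nat.not_even_iff_odd] at h
          exact Nat.Odd.sub_odd h odd_one
        have h0 : j - 1 + 1 = j := by
          have : j ≠ 0 := by rintro rfl; simp at h
          omega
        simp [tauBasis, tauSign, h, h', h0]
  | add v w hv hw => simp [hv, hw]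
  | smul c v hv => rw [map_smulₛₗ, map_smulₛₗ, hv, Complex.conj_conj, smul_comm]

theorem tau_injective : Function.Injective (tau E 𝔽) := fun v w h => by
  have := congrArg (tau E 𝔽) h
  rw [tau_tau, tau_tau] at this
  exact smul_right_injective V (tauSign_ne_zero 𝔽) this

theorem tau_mem_map {X : Submodule ℂ V} {v : V} : tau E 𝔽 v ∈ X.map (tau E 𝔽) ↔ v ∈ X :=
  ⟨fun ⟨_, hw, h⟩ => tau_injective E 𝔽 h ▸ hw, fun h => ⟨v, h, rfl⟩⟩

theorem mem_map_tau {X : Submodule ℂ V} {v : V} : v ∈ X.map (tau E 𝔽) ↔ tau E 𝔽 v ∈ X := by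
  rw [← tau_mem_map E 𝔽 (X := X), tau_tau]
  exact ((X.map (tau E 𝔽)).smul_mem_iff (tauSign_ne_zero 𝔽)).symm

theorem map_tau_map_tau (X : Submodule ℂ V) : (X.map (tau E 𝔽)).map (tau E 𝔽) = X := by
  ext v
  rw [mem_map_tau, tau_mem_map]

theorem map_tau_inf (X Y : Submodule ℂ V) :
    (X ⊓ Y).map (tau E 𝔽) = X.map (tau E 𝔽) ⊓ Y.map (tau E 𝔽) :=
  Submodule.map_inf _ (tau_injective E 𝔽)

theorem map_tau_top : (⊤ : Submodule ℂ V).map (tau E 𝔽) = ⊤ := by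
  ext v
  rw [mem_map_tau]
  exact iff_of_true Submodule.mem_top Submodule.mem_top

theorem map_tau_lt {X Y : Submodule ℂ V} :
    X.map (tau E 𝔽) < Y.map (tau E 𝔽) ↔ X < Y := by
  have h : ∀ X Y : Submodule ℂ V, X.map (tau E 𝔽) ≤ Y.map (tau E 𝔽) ↔ X ≤ Y := fun X Y =>
    ⟨fun h v hv => (tau_mem_map E 𝔽).1 (h ⟨v, hv, rfl⟩), fun h => Submodule.map_mono h⟩
  rw [lt_iff_le_not_ge, lt_iff_le_not_ge, h, h]

theorem finrank_map_tau (X : Submodule ℂ V) : finrank ℂ (X.map (tau E 𝔽)) = finrank ℂ X := by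
  have e := Submodule.equivMapOfInjective (tau E 𝔽) (tau_injective E 𝔽) X
  have := rank_eq_of_equiv_equiv (starRingEnd ℂ) e.toAddEquiv
    (starRingAut (R := ℂ)).bijective (fun r x => e.map_smulₛₗ r x)
  exact (congrArg Cardinal.toNat this).symm

variable {m : ℕ}

/-- Cutting at an even index keeps together the pairs of basis vectors that the quaternionic τ
exchanges up to sign. -/
theorem tau_trunc (hm : Even m) (v : V) : tau E 𝔽 (trunc E m v) = trunc E m (tau E 𝔽 v) := by
  induction v using basis_induction E with
  | zero => simp
  | coe j =>
    cases 𝔽 with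
    | real =>
      rcases lt_or_ge j m with h | h
      · simp [trunc_basis_lt E h, tauBasis]
      · simp [trunc_basis_ge E h, tauBasis]
    | quaternion =>
      rcases lt_or_ge j m with h | h
      · rw [trunc_basis_lt E h, tau_basis]
        by_cases hj : Even j
        · have : j + 1 < m := by
            rcases Nat.lt_or_ge (j + 1) m with h' | h'
            · exact h'
            · have : m = j + 1 := by omega
              rw [this, Nat.even_add_one] at hm
              exact absurd hj hm
          simp [tauBasis, hj, trunc_basis_lt E this]
        · simp [tauBasis, hj, trunc_basis_lt E (show j - 1 < m by omega)]
      · rw [trunc_basis_ge E h, tau_basis]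
        by_cases hj : Even j
        · simp [tauBasis, hj, trunc_basis_ge E (show m ≤ j + 1 by omega)]
        · have : m ≤ j - 1 := by
            rcases eq_or_lt_of_le h with h' | h'
            · exact absurd (h' ▸ hm) hj
            · omega
          simp [tauBasis, hj, trunc_basis_ge E this]
  | add v w hv hw => simp [hv, hw]
  | smul c v hv => simp [map_smulₛₗ, hv]

theorem map_tau_lo (hm : Even m) : (lo E m).map (tau E 𝔽) = lo E m := by
  ext v
  rw [mem_map_tau, mem_lo, mem_lo, ← tau_trunc E 𝔽 hm, (tau_injective E 𝔽).eq_iff]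

theorem map_tau_hi (hm : Even m) : (hi E m).map (tau E 𝔽) = hi E m := by
  ext v
  rw [mem_map_tau, mem_hi, mem_hi, ← tau_trunc E 𝔽 hm, map_eq_zero_iff _ (tau_injective E 𝔽)]

theorem isSplit_map_tau (hm : Even m) {X : Submodule ℂ V} (hX : IsSplit E m X) :
    IsSplit E m (X.map (tau E 𝔽)) := by
  rintro _ ⟨v, hv, rfl⟩
  rw [← tau_trunc E 𝔽 hm, tau_mem_map]
  exact hX v hv

/-- The conjugate linear map of `ℂ^m` induced by `τ`. -/
noncomputable def tauFin (m : ℕ) : (Fin m → ℂ) →ₛₗ[starRingEnd ℂ] (Fin m → ℂ) where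
  toFun x := coords E m (tau E 𝔽 (emb E m x))
  map_add' := by simp
  map_smul' c x := by simp [map_smulₛₗ]

theorem emb_tauFin (hm : Even m) (x : Fin m → ℂ) :
    emb E m (tauFin E 𝔽 m x) = tau E 𝔽 (emb E m x) := by
  change emb E m (coords E m (tau E 𝔽 (emb E m x))) = _
  rw [emb_coords, ← tau_trunc E 𝔽 hm, trunc_emb]

theorem coords_tau (hm : Even m) (v : V) :
    coords E m (tau E 𝔽 v) = tauFin E 𝔽 m (coords E m v) := by
  apply emb_injective E m
  rw [emb_tauFin E 𝔽 hm, emb_coords, emb_coords, tau_trunc E 𝔽 hm]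

theorem tauFin_tauFin (hm : Even m) (x : Fin m → ℂ) :
    tauFin E 𝔽 m (tauFin E 𝔽 m x) = tauSign 𝔽 • x := by
  apply emb_injective E m
  rw [emb_tauFin E 𝔽 hm, emb_tauFin E 𝔽 hm, tau_tau, map_smul]

end Tau

/-! ### Splitting of weakly compatible flags -/

theorem exists_eq_span_of_mem {X : Basis ℕ ℂ V} {L : Set (Submodule ℂ V)}
    (hL : IsGeneralizedFlag L) (hX : IsCompatible X L) {W : Submodule ℂ V} (hW : W ∈ L) :
    ∃ S : Set ℕ, W = Submodule.span ℂ (X '' S) := by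
  obtain ⟨prec, -, h⟩ := hX
  rcases hL.pair W hW with ⟨S, hS⟩ | ⟨P, hP⟩
  · obtain ⟨a, ha, -⟩ := h _ _ hS
    exact ⟨_, ha⟩
  · obtain ⟨a, -, ha⟩ := h _ _ hP
    exact ⟨_, ha⟩

/-- For large m every `E j` with j ≥ m occurs in X, and these vectors span the kernel of the first m
coordinates. The other vectors of X stay independent in ℂ^m, so they are finite in number. -/
theorem finite_setOf_notMem_range (E X : Basis ℕ ℂ V) (h : (Set.range E \ Set.range X).Finite) :
    {a | X a ∉ Set.range E}.Finite := by
  obtain ⟨m, hm⟩ := exists_le_lo E h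
  have h1 : ∀ j, m ≤ j → E j ∈ Set.range X := by
    intro j hj
    by_contra hjX
    have := mem_lo.1 (hm ⟨⟨j, rfl⟩, hjX⟩)
    rw [trunc_basis_ge E hj] at this
    exact E.ne_zero j this.symm
  let S : Set ℕ := {a | ∃ j, m ≤ j ∧ X a = E j}
  have h2 : hi E m ≤ Submodule.span ℂ (X '' S) := by
    have h3 : ∀ v : V, v - trunc E m v ∈ Submodule.span ℂ (X '' S) := by
      intro v
      induction v using basis_induction E with
      | zero => simp
      | coe j =>
        rcases lt_or_ge j m with hj | hj
        · simp [trunc_basis_lt E hj]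
        · obtain ⟨a, ha⟩ := h1 j hj
          rw [trunc_basis_ge E hj, sub_zero]
          exact Submodule.subset_span ⟨a, ⟨j, hj, ha⟩, ha⟩
      | add v w hv hw =>
        rw [map_add, add_sub_add_comm]
        exact add_mem hv hw
      | smul c v hv =>
        rw [map_smul, ← smul_sub]
        exact Submodule.smul_mem _ _ hv
    intro v hv
    have := h3 v
    rwa [mem_hi.1 hv, sub_zero] at this
  have h4 : LinearIndependent ℂ (coords E m ∘ fun a : (Sᶜ : Set ℕ) => X a) := by
    refine (X.linearIndependent.comp _ Subtype.val_injective).map ?_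
    have h5 := X.linearIndependent.disjoint_span_image (disjoint_compl_left (a := S))
    refine Disjoint.mono ?_ ?_ h5
    · refine Submodule.span_mono ?_
      rintro _ ⟨a, rfl⟩
      exact ⟨a, a.2, rfl⟩
    · intro v hv
      exact h2 (mem_hi_iff_coords.2 hv)
  have := h4.finite
  have h6 : (Sᶜ : Set ℕ).Finite := Set.toFinite _
  refine h6.subset fun a ha hS => ?_
  obtain ⟨j, -, hj⟩ := hS
  exact ha ⟨j, hj.symm⟩

/-- Members are spanned by vectors of X. For large m each vector of X is either some `E j`, fixed or
killed by the truncation, or one of finitely many others, all of which lie in `lo E m`. -/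
theorem exists_forall_isSplit {E : Basis ℕ ℂ V} {L : Set (Submodule ℂ V)}
    (hL : IsGeneralizedFlag L) (hE : IsWeaklyCompatible E L) :
    ∃ m₀, ∀ m ≥ m₀, ∀ W ∈ L, IsSplit E m W := by
  obtain ⟨X, hfin, hX⟩ := hE
  obtain ⟨m₀, hm₀⟩ := exists_le_lo E ((finite_setOf_notMem_range E X hfin).image X)
  refine ⟨m₀, fun m hm W hW => ?_⟩
  obtain ⟨S, rfl⟩ := exists_eq_span_of_mem hL hX hW
  suffices h : Submodule.span ℂ (X '' S) ≤ (Submodule.span ℂ (X '' S)).comap (trunc E m) from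
    fun v hv => h hv
  refine Submodule.span_le.2 ?_
  rintro _ ⟨a, ha, rfl⟩
  change trunc E m (X a) ∈ Submodule.span ℂ (X '' S)
  have hmem : X a ∈ Submodule.span ℂ (X '' S) := Submodule.subset_span ⟨a, ha, rfl⟩
  by_cases haE : X a ∈ Set.range E
  · obtain ⟨j, hj⟩ := haE
    rcases lt_or_ge j m with h | h
    · rw [← hj, trunc_basis_lt E h, hj]; exact hmem
    · rw [← hj, trunc_basis_ge E h]; exact zero_mem _
  · rw [mem_lo.1 (lo_mono hm (hm₀ ⟨a, haE, rfl⟩))]; exact hmem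

/-! ### Commensurations -/

theorem IsCommensuration.exists_isComm_lo (E : Basis ℕ ℂ V) {L M : Set (Submodule ℂ V)} {φ : L ≃ M}
    (h : IsCommensuration φ) : ∃ m₀, ∀ m ≥ m₀, ∀ W : L, IsComm (lo E m) W.1 (φ W).1 := by
  obtain ⟨U, hU, h⟩ := h
  obtain ⟨m₀, hm₀⟩ := exists_finiteDimensional_le_lo E U
  exact ⟨m₀, fun m hm W => IsComm.mono (U := U) (h W) (hm₀.trans (lo_mono hm))⟩

theorem isCommensuration_of_isComm {E : Basis ℕ ℂ V} {m : ℕ} {L M : Set (Submodule ℂ V)} {φ : L ≃ M}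
    (h : ∀ W : L, IsComm (lo E m) W.1 (φ W).1) : IsCommensuration φ :=
  ⟨lo E m, inferInstance, h⟩

theorem IsCommensuration.symm {L M : Set (Submodule ℂ V)} {φ : L ≃ M}
    (h : IsCommensuration φ) : IsCommensuration φ.symm := by
  obtain ⟨U, hU, h⟩ := h
  refine ⟨U, hU, fun W => ?_⟩
  have h1 : IsComm U (φ.symm W).1 (φ (φ.symm W)).1 := h (φ.symm W)
  rw [φ.apply_symm_apply] at h1
  exact h1.symm

theorem IsCommensuration.trans (E : Basis ℕ ℂ V) {L M N : Set (Submodule ℂ V)} {φ : L ≃ M} {ψ : M ≃ N}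
    (h : IsCommensuration φ) (h' : IsCommensuration ψ) : IsCommensuration (φ.trans ψ) := by
  obtain ⟨m, hm⟩ := h.exists_isComm_lo E
  obtain ⟨n, hn⟩ := h'.exists_isComm_lo E
  exact isCommensuration_of_isComm (E := E) (m := max m n) fun W =>
    (hm _ (le_max_left _ _) W).trans (hn _ (le_max_right _ _) (φ W))

/-- The two images of W are comparable members of a chain and commensurable with each other, hence
equal. -/
theorem IsCommensuration.unique (E : Basis ℕ ℂ V) {L M : Set (Submodule ℂ V)}
    (hM : IsGeneralizedFlag M) {φ ψ : L ≃ M} (h : IsCommensuration φ) (h' : IsCommensuration ψ) :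
    φ = ψ := by
  obtain ⟨m, hm⟩ := h.exists_isComm_lo E
  obtain ⟨n, hn⟩ := h'.exists_isComm_lo E
  refine Equiv.ext fun W => Subtype.ext ?_
  have h1 := (hm _ (le_max_left m n) W).symm.trans (hn _ (le_max_right m n) W)
  rcases hM.chain _ (φ W).2 _ (ψ W).2 with h2 | h2
  · exact h1.eq_of_le h2
  · exact (h1.symm.eq_of_le h2).symm

/-- Commensurable flags agree beyond some coordinate, and have members of the same dimensions
before it. -/
theorem exists_normal_form {E : Basis ℕ ℂ V} {L M : Set (Submodule ℂ V)}
    (hL : IsGeneralizedFlag L) (hLE : IsWeaklyCompatible E L)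
    (hM : IsGeneralizedFlag M) (hME : IsWeaklyCompatible E M) {φ : L ≃ M}
    (h : IsCommensuration φ) :
    ∃ m₀, ∀ m ≥ m₀, ∀ W : L, IsSplit E m W.1 ∧ IsSplit E m (φ W).1 ∧
      W.1 ⊓ hi E m = (φ W).1 ⊓ hi E m ∧
      finrank ℂ (W.1.comap (emb E m)) = finrank ℂ ((φ W).1.comap (emb E m)) ∧
      IsComm (lo E m) W.1 (φ W).1 := by
  obtain ⟨a, ha⟩ := exists_forall_isSplit hL hLE
  obtain ⟨b, hb⟩ := exists_forall_isSplit hM hME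
  obtain ⟨c, hc⟩ := h.exists_isComm_lo E
  refine ⟨max a (max b c), fun m hm W => ?_⟩
  have h1 := ha m (by omega) _ W.2
  have h2 := hb m (by omega) _ (φ W).2
  have h3 := hc m (by omega) W
  refine ⟨h1, h2, inf_hi_eq_of_sup_lo_eq h1 h2 h3.sup_eq, ?_, h3⟩
  rw [finrank_comap_emb, finrank_comap_emb, h3.2.2]

/-! ### The action of `SL(∞; ℂ)` on flags -/

section Move

variable (g : LinearMap.GeneralLinearGroup ℂ V)

theorem map_gl_le {X Y : Submodule ℂ V} : X.map g.val ≤ Y.map g.val ↔ X ≤ Y :=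
  ⟨fun h v hv => mem_map_gl.1 (h ⟨v, hv, rfl⟩), fun h => Submodule.map_mono h⟩

theorem map_gl_lt {X Y : Submodule ℂ V} : X.map g.val < Y.map g.val ↔ X < Y := by
  rw [lt_iff_le_not_ge, lt_iff_le_not_ge, map_gl_le, map_gl_le]

theorem map_gl_injective : Function.Injective fun X : Submodule ℂ V => X.map g.val :=
  Submodule.map_injective_of_injective (gl_injective g)

theorem moveFlag_mul (h : LinearMap.GeneralLinearGroup ℂ V) (L : Set (Submodule ℂ V)) :
    moveFlag (g * h) L = moveFlag g (moveFlag h L) := by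
  unfold moveFlag
  rw [Set.image_image]
  refine Set.image_congr fun W _ => ?_
  rw [Units.val_mul, ← Submodule.map_comp]
  rfl

theorem moveFlag_one (L : Set (Submodule ℂ V)) : moveFlag 1 L = L := by
  unfold moveFlag
  have : (fun W : Submodule ℂ V =>
      W.map ((1 : LinearMap.GeneralLinearGroup ℂ V) : V →ₗ[ℂ] V)) = id :=
    funext fun W => Submodule.map_id W
  rw [this, Set.image_id]

theorem isImmediatePair_moveFlag {L : Set (Submodule ℂ V)} {P S : Submodule ℂ V} :
    IsImmediatePair (moveFlag g L) (P.map g.val) (S.map g.val) ↔ IsImmediatePair L P S := by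
  have hmem : ∀ X : Submodule ℂ V, X.map g.val ∈ moveFlag g L ↔ X ∈ L := fun X =>
    (map_gl_injective g).mem_set_image
  constructor
  · rintro ⟨h1, h2, h3, h4⟩
    exact ⟨(hmem _).1 h1, (hmem _).1 h2, (map_gl_lt g).1 h3, fun W hW hlt =>
      h4 _ ((hmem W).2 hW) ⟨(map_gl_lt g).2 hlt.1, (map_gl_lt g).2 hlt.2⟩⟩
  · rintro ⟨h1, h2, h3, h4⟩
    refine ⟨(hmem _).2 h1, (hmem _).2 h2, (map_gl_lt g).2 h3, ?_⟩
    rintro _ ⟨W, hW, rfl⟩ hlt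
    exact h4 W hW ⟨(map_gl_lt g).1 hlt.1, (map_gl_lt g).1 hlt.2⟩

theorem isGeneralizedFlag_moveFlag {L : Set (Submodule ℂ V)} (hL : IsGeneralizedFlag L) :
    IsGeneralizedFlag (moveFlag g L) where
  chain := by
    rintro _ ⟨P, hP, rfl⟩ _ ⟨S, hS, rfl⟩
    exact (hL.chain P hP S hS).imp (Submodule.map_mono ·) (Submodule.map_mono ·)
  pair := by
    rintro _ ⟨W, hW, rfl⟩
    exact (hL.pair W hW).imp (fun ⟨S, hS⟩ => ⟨_, (isImmediatePair_moveFlag g).2 hS⟩)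
      (fun ⟨S, hS⟩ => ⟨_, (isImmediatePair_moveFlag g).2 hS⟩)
  cover := by
    intro v hv
    obtain ⟨w, rfl⟩ := gl_surjective g v
    have hw : w ≠ 0 := by rintro rfl; simp at hv
    obtain ⟨P, S, h, hS, hP⟩ := hL.cover w hw
    exact ⟨_, _, (isImmediatePair_moveFlag g).2 h, mem_map_gl.2 hS, fun h => hP (mem_map_gl.1 h)⟩

theorem isCompatible_moveFlag {X : Basis ℕ ℂ V} {L : Set (Submodule ℂ V)} (hX : IsCompatible X L) :
    IsCompatible (X.map (LinearMap.GeneralLinearGroup.generalLinearEquiv ℂ V g))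
      (moveFlag g L) := by
  obtain ⟨prec, h1, h2⟩ := hX
  refine ⟨prec, h1, fun P S h => ?_⟩
  obtain ⟨P, -, rfl⟩ := h.1
  obtain ⟨S, -, rfl⟩ := h.2.1
  obtain ⟨a, rfl, rfl⟩ := h2 P S ((isImmediatePair_moveFlag g).1 h)
  refine ⟨a, ?_, ?_⟩
  all_goals
    simp only [Submodule.map_span, Set.image_image]
    rfl

/-- The bijection from a flag to its image under `g`. -/
noncomputable def moveEquiv (L : Set (Submodule ℂ V)) : L ≃ moveFlag g L :=
  Equiv.Set.image _ L (map_gl_injective g)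

variable {g} {E : Basis ℕ ℂ V}

theorem isWeaklyCompatible_moveFlag (hg : g ∈ specialLinear E) {L : Set (Submodule ℂ V)}
    (hL : IsWeaklyCompatible E L) : IsWeaklyCompatible E (moveFlag g L) := by
  obtain ⟨X, hfin, hX⟩ := hL
  obtain ⟨m, A, rfl⟩ := hg
  refine ⟨_, ?_, isCompatible_moveFlag _ hX⟩
  refine (hfin.union ((Set.finite_lt_nat m).image E)).subset ?_
  rintro _ ⟨⟨j, rfl⟩, hj⟩
  by_contra hcon
  rw [Set.mem_union, not_or] at hcon
  have h1 : m ≤ j := by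
    by_contra h
    exact hcon.2 ⟨j, not_le.1 h, rfl⟩
  have h2 : E j ∈ Set.range X := by
    by_contra h
    exact hcon.1 ⟨⟨j, rfl⟩, h⟩
  obtain ⟨a, ha⟩ := h2
  refine hj ⟨a, ?_⟩
  rw [Basis.map_apply, ha]
  exact matrixMap_ge E A.1 h1

theorem isCommensuration_moveEquiv (hg : g ∈ specialLinear E) (L : Set (Submodule ℂ V)) :
    IsCommensuration (moveEquiv g L) := by
  obtain ⟨m, A, rfl⟩ := hg
  exact isCommensuration_of_isComm (E := E) (m := m) fun W => isComm_map_slHom E A W.1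

/-- The action of `SL(∞; ℂ)` on the flag manifold. -/
def FlagManifold.move {𝓕 : Set (Submodule ℂ V)} (hg : g ∈ specialLinear E)
    (L : FlagManifold E 𝓕) : FlagManifold E 𝓕 :=
  ⟨moveFlag g L.1, isGeneralizedFlag_moveFlag g L.2.1, L.2.2.1,
    isWeaklyCompatible_moveFlag hg L.2.2.2.1, by
      obtain ⟨φ, hφ⟩ := L.2.2.2.2
      exact ⟨φ.trans (moveEquiv g L.1), hφ.trans E (isCommensuration_moveEquiv hg L.1)⟩⟩

/-- The base point of the flag manifold. -/
def FlagManifold.base {𝓕 : Set (Submodule ℂ V)} (hflag : IsGeneralizedFlag 𝓕)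
    (hcomp : IsCompatible E 𝓕) : FlagManifold E 𝓕 :=
  have h : IsWeaklyCompatible E 𝓕 := ⟨E, by simp, hcomp⟩
  ⟨𝓕, hflag, h, h, Equiv.refl _, isCommensuration_of_isComm (E := E) (m := 0)
    fun _ => ⟨le_sup_left, le_sup_left, rfl⟩⟩

theorem FlagManifold.exists_commensuration {𝓕 : Set (Submodule ℂ V)} (L M : FlagManifold E 𝓕) :
    ∃ φ : L.1 ≃ M.1, IsCommensuration φ := by
  obtain ⟨φ, hφ⟩ := L.2.2.2.2
  obtain ⟨ψ, hψ⟩ := M.2.2.2.2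
  exact ⟨φ.symm.trans ψ, hφ.symm.trans E hψ⟩

/-- An element of `SL(∞; ℂ)` that leaves a flag invariant leaves its members invariant. -/
theorem map_eq_of_moveFlag_eq (hg : g ∈ specialLinear E)
    {h : LinearMap.GeneralLinearGroup ℂ V} (hh : h ∈ specialLinear E) {L : Set (Submodule ℂ V)}
    (hL : IsGeneralizedFlag L) (hgh : moveFlag g L = moveFlag h L) {W : Submodule ℂ V}
    (hW : W ∈ L) : W.map g.val = W.map h.val := by
  have h1 := isCommensuration_moveEquiv hg L
  have h2 := isCommensuration_moveEquiv hh L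
  have h3 : IsCommensuration ((moveEquiv h L).trans (Equiv.setCongr hgh.symm)) := h2
  have := congrArg (fun φ => (φ ⟨W, hW⟩).1) (h1.unique E (isGeneralizedFlag_moveFlag g hL) h3)
  exact this

end Move

/-! ### Homogeneity of the flag manifold -/

/-- The map fixes the component beyond m, where X and Y agree, so only the first m coordinates
matter. -/
theorem matrixMap_mem {E : Basis ℕ ℂ V} {m : ℕ} {A : Matrix (Fin m) (Fin m) ℂ}
    {X Y : Submodule ℂ V} (hX : IsSplit E m X) (hY : IsSplit E m Y)
    (h : X ⊓ hi E m = Y ⊓ hi E m)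
    (hA : ∀ x ∈ X.comap (emb E m), A.mulVec x ∈ Y.comap (emb E m)) {v : V} (hv : v ∈ X) :
    matrixMap E m A v ∈ Y := by
  rw [mem_iff_of_isSplit hY, coords_matrixMap, matrixMap_sub_trunc]
  rw [mem_iff_of_isSplit hX] at hv
  refine ⟨hA _ hv.1, ?_⟩
  have : v - trunc E m v ∈ X ⊓ hi E m := ⟨hv.2, sub_trunc_mem_hi v⟩
  exact (h ▸ this).1

theorem matrixMap_diagonal_mem_span (E : Basis ℕ ℂ V) {m : ℕ} (d : Fin m → ℂ) (S : Set ℕ) {v : V}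
    (hv : v ∈ Submodule.span ℂ (E '' S)) :
    matrixMap E m (Matrix.diagonal d) v ∈ Submodule.span ℂ (E '' S) := by
  induction hv using Submodule.span_induction with
  | mem x hx =>
    obtain ⟨j, hj, rfl⟩ := hx
    have hE : E j ∈ Submodule.span ℂ (E '' S) := Submodule.subset_span ⟨j, hj, rfl⟩
    rcases lt_or_ge j m with h | h
    · rw [show E j = E ((⟨j, h⟩ : Fin m) : ℕ) from rfl, matrixMap_lt]
      simp only [Matrix.diagonal_apply, ite_smul, zero_smul, Finset.sum_ite_eq', Finset.mem_univ,
        if_true]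
      exact Submodule.smul_mem _ _ hE
    · rw [matrixMap_ge E _ h]; exact hE
  | zero => simp
  | add v w _ _ hv hw => rw [map_add]; exact add_mem hv hw
  | smul c v _ hv => rw [map_smul]; exact Submodule.smul_mem _ _ hv

/-- The flag manifold is the `SL(∞; ℂ)`-orbit of its base point. -/
theorem FlagManifold.exists_eq_moveFlag {E : Basis ℕ ℂ V} {𝓕 : Set (Submodule ℂ V)}
    (hflag : IsGeneralizedFlag 𝓕) (hcomp : IsCompatible E 𝓕) (L : FlagManifold E 𝓕) :
    ∃ g ∈ specialLinear E, L.1 = moveFlag g 𝓕 := by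
  obtain ⟨φ, hφ⟩ := L.2.2.2.2
  obtain ⟨m₀, hm₀⟩ := exists_normal_form hflag L.2.2.1 L.2.1 L.2.2.2.1 hφ
  obtain ⟨m, hm, hmpos⟩ : ∃ m, m₀ ≤ m ∧ 0 < m := ⟨m₀ + 1, by omega, by omega⟩
  have hnf := hm₀ m hm
  -- A single chain suffices here, so the second one is empty.
  obtain ⟨g, hg, -⟩ := exists_equiv_of_chains (ι := 𝓕) (κ := Empty)
    (fun W => W.1.comap (emb E m)) Empty.elim (fun W => (φ W).1.comap (emb E m)) Empty.elim rfl
    (fun W W' => (hflag.chain _ W.2 _ W'.2).imp (Submodule.comap_mono ·) (Submodule.comap_mono ·))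
    (fun i => i.elim)
    (fun W W' => (L.2.1.chain _ (φ W).2 _ (φ W').2).imp (Submodule.comap_mono ·)
      (Submodule.comap_mono ·))
    (fun i => i.elim) (fun W => (hnf W).2.2.2.1) (fun i => i.elim) (fun _ i => i.elim)
  have hdet : IsUnit (LinearMap.toMatrix' (g : (Fin m → ℂ) →ₗ[ℂ] (Fin m → ℂ))).det := by
    rw [LinearMap.det_toMatrix']; exact LinearEquiv.isUnit_det' g
  let c := (LinearMap.toMatrix' (g : (Fin m → ℂ) →ₗ[ℂ] (Fin m → ℂ))).det
  -- Rescaling `E 0` brings the determinant to 1 and preserves the members of `𝓕`, which are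
  -- coordinate subspaces.
  let d : Fin m → ℂ := Function.update 1 ⟨0, hmpos⟩ c⁻¹
  let A : Matrix.SpecialLinearGroup (Fin m) ℂ :=
    ⟨LinearMap.toMatrix' (g : (Fin m → ℂ) →ₗ[ℂ] (Fin m → ℂ)) * Matrix.diagonal d, by
      rw [Matrix.det_mul, Matrix.det_diagonal, Finset.prod_update_of_mem (Finset.mem_univ _)]
      simp only [Pi.one_apply, Finset.prod_const_one, mul_one]
      exact mul_inv_cancel₀ hdet.ne_zero⟩
  have key : ∀ W : 𝓕, W.1.map (slHom E m A).val = (φ W).1 := by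
    intro W
    refine IsComm.eq_of_le ((isComm_map_slHom E A W.1).symm.trans (hnf W).2.2.2.2) ?_
    rintro _ ⟨v, hv, rfl⟩
    rw [coe_slHom, show A.1 = LinearMap.toMatrix' (g : (Fin m → ℂ) →ₗ[ℂ] (Fin m → ℂ)) *
      Matrix.diagonal d from rfl, matrixMap_mul]
    refine matrixMap_mem (hnf W).1 (hnf W).2.1 (hnf W).2.2.1 (fun x hx => ?_)
      (v := matrixMap E m (Matrix.diagonal d) v) ?_
    · rw [LinearMap.toMatrix'_mulVec, ← hg W]
      exact ⟨x, hx, rfl⟩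
    · obtain ⟨S, hS⟩ := exists_eq_span_of_mem hflag hcomp W.2
      rw [hS] at hv ⊢
      exact matrixMap_diagonal_mem_span E d S hv
  refine ⟨slHom E m A, slHom_mem E A, ?_⟩
  ext Y
  constructor
  · intro hY
    refine ⟨(φ.symm ⟨Y, hY⟩).1, (φ.symm ⟨Y, hY⟩).2, ?_⟩
    simp only [key, Equiv.apply_symm_apply]
  · rintro ⟨W, hW, rfl⟩
    simp only [key ⟨W, hW⟩]
    exact (φ _).2

/-- Every member of `L` is in general position to every member of `τ L`. -/
def IsTransversal (E : Basis ℕ ℂ V) (𝔽 : ScalarCase) (L : Set (Submodule ℂ V)) : Prop :=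
  ∀ W ∈ L, ∀ W' ∈ L, W ⊓ W'.map (tau E 𝔽) = ⊥ ∨ W ⊔ W'.map (tau E 𝔽) = ⊤

/-! ### Perturbation of pairs that are not in general position -/

theorem conj_repr_tau_real (E : Basis ℕ ℂ V) (v : V) (a : ℕ) :
    starRingEnd ℂ (E.repr (tau E .real v) a) = E.repr v a := by
  induction v using basis_induction E with
  | zero => simp
  | coe j => simp [tauBasis, Finsupp.single_apply, apply_ite (starRingEnd ℂ)]
  | add v w hv hw => simp [hv, hw]
  | smul c v hv => simp [map_smulₛₗ, hv]

/-- Over ℝ, if z is outside S, then so is z + τz or z − τz; the first is τ-fixed, the second becomes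
so after multiplication by i. Over ℍ, a relation ay + bτy ∈ S combined with its image under τ yields
(|a|² + |b|²)y ∈ S. -/
theorem exists_transverse_vector (E : Basis ℕ ℂ V) (𝔽 : ScalarCase) {S : Submodule ℂ V}
    (hS : ∀ v ∈ S, tau E 𝔽 v ∈ S) (hne : S ≠ ⊤) :
    ∃ y ∉ S, (𝔽 = .real ∧ tau E 𝔽 y = y) ∨
      ∀ a b : ℂ, a • y + b • tau E 𝔽 y ∈ S → a = 0 := by
  obtain ⟨z, hz⟩ : ∃ z, z ∉ S := by
    by_contra! h
    exact hne (eq_top_iff.2 fun v _ => h v)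
  cases 𝔽 with
  | real =>
    by_cases h1 : z + tau E .real z ∈ S
    · refine ⟨Complex.I • (z - tau E .real z), fun h2 => hz ?_, Or.inl ⟨rfl, ?_⟩⟩
      · have h3 := (S.smul_mem_iff Complex.I_ne_zero).1 h2
        have h4 : (2 : ℂ) • z ∈ S := by
          have := S.add_mem h1 h3
          rwa [add_add_sub_cancel, ← two_smul ℂ z] at this
        exact (S.smul_mem_iff two_ne_zero).1 h4
      · rw [map_smulₛₗ, map_sub, tau_tau, Complex.conj_I, tauSign, one_smul, neg_smul, ← smul_neg,
          neg_sub]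
    · exact ⟨_, h1, Or.inl ⟨rfl, by rw [map_add, tau_tau, tauSign, one_smul, add_comm]⟩⟩
  | quaternion =>
    refine ⟨z, hz, Or.inr fun a b h => ?_⟩
    have h1 := hS _ h
    rw [map_add, map_smulₛₗ, map_smulₛₗ, tau_tau, tauSign] at h1
    have h2 := S.sub_mem (S.smul_mem (starRingEnd ℂ a) h) (S.smul_mem b h1)
    have h3 : (starRingEnd ℂ) a • (a • z + b • (tau E .quaternion) z) -
        b • ((starRingEnd ℂ) a • (tau E .quaternion) z + (starRingEnd ℂ) b • (-1 : ℂ) • z) =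
        (a * starRingEnd ℂ a + b * starRingEnd ℂ b) • z := by module
    rw [h3] at h2
    by_contra ha
    refine hz ((S.smul_mem_iff ?_).1 h2)
    rw [Complex.mul_conj, Complex.mul_conj, ← Complex.ofReal_add, Complex.ofReal_ne_zero]
    have := Complex.normSq_pos.2 ha
    have := Complex.normSq_nonneg b
    linarith

/-- The functional `v ↦ i (y_b v_a - y_a v_b)`. -/
noncomputable def minor (E : Basis ℕ ℂ V) (y : V) (a b : ℕ) : V →ₗ[ℂ] ℂ :=
  Complex.I • (E.repr y b • E.coord a - E.repr y a • E.coord b)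

theorem minor_apply (E : Basis ℕ ℂ V) (y : V) (a b : ℕ) (v : V) :
    minor E y a b v = Complex.I * (E.repr y b * E.repr v a - E.repr y a * E.repr v b) := by
  simp [minor]

theorem minor_self (E : Basis ℕ ℂ V) (y : V) (a b : ℕ) : minor E y a b y = 0 := by
  rw [minor_apply]; ring

/-- If all minors vanish, x and y are proportional, which puts y into S. -/
theorem exists_minor_ne_zero (E : Basis ℕ ℂ V) {S : Submodule ℂ V} {x y : V} (hx : x ∈ S)
    (hx0 : x ≠ 0) (hy : y ∉ S) : ∃ a b, minor E y a b x ≠ 0 := by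
  by_contra! h
  have hy0 : y ≠ 0 := by rintro rfl; exact hy (zero_mem S)
  obtain ⟨b, hb⟩ : ∃ b, E.repr y b ≠ 0 := by
    by_contra! h'
    exact hy0 (E.repr.map_eq_zero_iff.1 (Finsupp.ext h'))
  have h1 : E.repr y b • x = E.repr x b • y := by
    apply E.repr.injective
    ext a
    have := h a b
    rw [minor_apply, mul_eq_zero, or_iff_right Complex.I_ne_zero, sub_eq_zero] at this
    simp [this, mul_comm]
  have h2 : E.repr x b ≠ 0 := by
    intro h0
    rw [h0, zero_smul, smul_eq_zero] at h1
    exact h1.elim hb hx0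
  exact hy ((S.smul_mem_iff h2).1 (h1 ▸ S.smul_mem _ hx))

/-- The factor i in `minor` serves to produce this sign. Without it the shear along a real y would
commute with τ and could not shrink anything. -/
theorem conj_minor_tau_real (E : Basis ℕ ℂ V) {y : V} (hy : tau E .real y = y) (a b : ℕ) (v : V) :
    starRingEnd ℂ (minor E y a b (tau E .real v)) = - minor E y a b v := by
  have h := conj_repr_tau_real E y
  rw [hy] at h
  simp only [minor_apply, map_mul, map_sub, Complex.conj_I, h, conj_repr_tau_real]
  ring

/-- The linear map `v ↦ v + t ξ(v) y` of `V`. -/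
noncomputable def shear (ξ : V →ₗ[ℂ] ℂ) (y : V) (t : ℝ) : V →ₗ[ℂ] V :=
  LinearMap.id + (t : ℂ) • ξ.smulRight y

theorem shear_apply (ξ : V →ₗ[ℂ] ℂ) (y : V) (t : ℝ) (v : V) :
    shear ξ y t v = v + ((t : ℂ) * ξ v) • y := by
  rw [mul_smul]; rfl

/-- Let S = X + τY and ξ = `minor E y a b`. For suitable y outside S the new intersection lies in X
∩ τY ∩ ker ξ, whatever a and b are. These are then chosen with ξ(x₀) ≠ 0 for a given nonzero x₀ in X
∩ τY. If Y is not inside S, take y in Y: the shear preserves Y, and only X moves. Otherwise S is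
τ-stable, and `exists_transverse_vector` supplies y. -/
theorem exists_shear_lt_of_le (E : Basis ℕ ℂ V) (𝔽 : ScalarCase) {X Y : Submodule ℂ V}
    (hXY : X ≤ Y) (h1 : X ⊓ Y.map (tau E 𝔽) ≠ ⊥) (h2 : X ⊔ Y.map (tau E 𝔽) ≠ ⊤) :
    ∃ (y : V) (a b : ℕ), ∀ t : ℝ, t ≠ 0 → X.map (shear (minor E y a b) y t) ⊓
      (Y.map (shear (minor E y a b) y t)).map (tau E 𝔽) < X ⊓ Y.map (tau E 𝔽) := by
  obtain ⟨x₀, hx₀, hx₀0⟩ := Submodule.exists_mem_ne_zero_of_ne_bot h1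
  have hx₀S : x₀ ∈ X ⊔ Y.map (tau E 𝔽) := Submodule.mem_sup_left hx₀.1
  suffices H : ∃ y ∉ X ⊔ Y.map (tau E 𝔽), ∀ a b (t : ℝ), t ≠ 0 → ∀ x ∈ X, ∀ w ∈ Y,
      shear (minor E y a b) y t x = tau E 𝔽 (shear (minor E y a b) y t w) →
      minor E y a b x = 0 ∧ x ∈ Y.map (tau E 𝔽) by
    obtain ⟨y, hyS, hy⟩ := H
    obtain ⟨a, b, hab⟩ := exists_minor_ne_zero E hx₀S hx₀0 hyS
    refine ⟨y, a, b, fun t ht => ?_⟩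
    have h3 : ∀ u ∈ X.map (shear (minor E y a b) y t) ⊓
        (Y.map (shear (minor E y a b) y t)).map (tau E 𝔽),
        u ∈ X ⊓ Y.map (tau E 𝔽) ∧ minor E y a b u = 0 := by
      rintro _ ⟨⟨x, hx, rfl⟩, ⟨_, ⟨w, hw, rfl⟩, hu⟩⟩
      obtain ⟨h4, h5⟩ := hy a b t ht x hx w hw hu.symm
      have h6 : shear (minor E y a b) y t x = x := by rw [shear_apply, h4]; simp
      rw [h6]
      exact ⟨⟨hx, h5⟩, h4⟩
    refine lt_of_le_of_ne (fun u hu => (h3 u hu).1) fun heq => hab (h3 x₀ (heq ▸ hx₀)).2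
  by_cases hY : Y ≤ X ⊔ Y.map (tau E 𝔽)
  · have hstab : ∀ v ∈ X ⊔ Y.map (tau E 𝔽), tau E 𝔽 v ∈ X ⊔ Y.map (tau E 𝔽) := by
      intro v hv
      obtain ⟨x, hx, z, hz, rfl⟩ := Submodule.mem_sup.1 hv
      rw [map_add]
      exact add_mem (Submodule.mem_sup_right ⟨x, hXY hx, rfl⟩) (hY ((mem_map_tau E 𝔽).1 hz))
    obtain ⟨y, hyS, hy⟩ := exists_transverse_vector E 𝔽 hstab h2
    refine ⟨y, hyS, fun a b t ht x hx w hw hxw => ?_⟩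
    have ht' : (t : ℂ) ≠ 0 := Complex.ofReal_ne_zero.2 ht
    rw [shear_apply, shear_apply, map_add, map_smulₛₗ, map_mul, Complex.conj_ofReal] at hxw
    have hmem : ((t : ℂ) * minor E y a b x) • y +
        (-((t : ℂ) * starRingEnd ℂ (minor E y a b w))) • tau E 𝔽 y ∈ X ⊔ Y.map (tau E 𝔽) := by
      have : ((t : ℂ) * minor E y a b x) • y +
          (-((t : ℂ) * starRingEnd ℂ (minor E y a b w))) • tau E 𝔽 y = tau E 𝔽 w - x := by
        rw [neg_smul, ← sub_eq_add_neg, sub_eq_sub_iff_add_eq_add, add_comm _ x, hxw]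
      rw [this]
      exact sub_mem (Submodule.mem_sup_right ⟨w, hw, rfl⟩) (Submodule.mem_sup_left hx)
    rcases hy with ⟨rfl, hy⟩ | hy
    · rw [hy, ← add_smul, ← sub_eq_add_neg, ← mul_sub] at hmem
      have h3 : minor E y a b x = starRingEnd ℂ (minor E y a b w) := by
        by_contra hne
        exact hyS (((X ⊔ Y.map (tau E .real)).smul_mem_iff
          (mul_ne_zero ht' (sub_ne_zero.2 hne))).1 hmem)
      rw [hy, h3] at hxw
      have hxw := add_right_cancel hxw
      refine ⟨?_, hxw ▸ ⟨w, hw, rfl⟩⟩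
      have h4 := conj_minor_tau_real E hy a b x
      -- Now ξ(x) is the conjugate of ξ(τx), while `conj_minor_tau_real` says that it is minus that;
      -- hence ξ(x) = 0.
      have h5 : tau E .real x = w := by rw [hxw, tau_tau, tauSign, one_smul]
      rw [h5, ← h3] at h4
      exact self_eq_neg.1 h4
    · have h3 : minor E y a b x = 0 :=
        (mul_eq_zero.1 (hy _ _ hmem)).resolve_left ht'
      refine ⟨h3, ?_⟩
      have h6 : (-((t : ℂ) * starRingEnd ℂ (minor E y a b w))) • tau E 𝔽 y ∈
          X ⊔ Y.map (tau E 𝔽) := by simpa [h3] using hmem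
      have h4 : minor E y a b w = 0 := by
        by_contra hne
        have hc : (-((t : ℂ) * starRingEnd ℂ (minor E y a b w))) ≠ 0 :=
          neg_ne_zero.2 (mul_ne_zero ht' ((map_ne_zero _).2 hne))
        have h7 := hstab _ (((X ⊔ Y.map (tau E 𝔽)).smul_mem_iff hc).1 h6)
        rw [tau_tau] at h7
        exact hyS (((X ⊔ Y.map (tau E 𝔽)).smul_mem_iff (tauSign_ne_zero 𝔽)).1 h7)
      rw [h3, h4] at hxw
      have hxw : x = tau E 𝔽 w := by simpa using hxw
      exact hxw ▸ ⟨w, hw, rfl⟩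
  · obtain ⟨y, hyY, hyS⟩ := Set.not_subset.1 hY
    refine ⟨y, hyS, fun a b t ht x hx w hw hxw => ?_⟩
    have ht' : (t : ℂ) ≠ 0 := Complex.ofReal_ne_zero.2 ht
    have hw' : shear (minor E y a b) y t w ∈ Y := by
      rw [shear_apply]; exact add_mem hw (Y.smul_mem _ hyY)
    have hz : shear (minor E y a b) y t x ∈ Y.map (tau E 𝔽) := hxw ▸ ⟨_, hw', rfl⟩
    have h3 : minor E y a b x = 0 := by
      by_contra hne
      refine hyS (((X ⊔ Y.map (tau E 𝔽)).smul_mem_iff (mul_ne_zero ht' hne)).1 ?_)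
      have := sub_mem (Submodule.mem_sup_right (S := X) hz) (Submodule.mem_sup_left hx)
      rw [shear_apply, add_sub_cancel_left] at this
      exact this
    refine ⟨h3, ?_⟩
    rw [shear_apply, h3] at hz
    simpa using hz

theorem inf_map_tau_eq (E : Basis ℕ ℂ V) (𝔽 : ScalarCase) (X Y : Submodule ℂ V) :
    (Y ⊓ X.map (tau E 𝔽)).map (tau E 𝔽) = X ⊓ Y.map (tau E 𝔽) := by
  rw [map_tau_inf, map_tau_map_tau, inf_comm]

theorem sup_map_tau_eq (E : Basis ℕ ℂ V) (𝔽 : ScalarCase) (X Y : Submodule ℂ V) :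
    (Y ⊔ X.map (tau E 𝔽)).map (tau E 𝔽) = X ⊔ Y.map (tau E 𝔽) := by
  rw [Submodule.map_sup, map_tau_map_tau, sup_comm]

theorem exists_shear_lt (E : Basis ℕ ℂ V) (𝔽 : ScalarCase) {X Y : Submodule ℂ V}
    (hXY : X ≤ Y ∨ Y ≤ X) (h1 : X ⊓ Y.map (tau E 𝔽) ≠ ⊥) (h2 : X ⊔ Y.map (tau E 𝔽) ≠ ⊤) :
    ∃ (y : V) (a b : ℕ), ∀ t : ℝ, t ≠ 0 → X.map (shear (minor E y a b) y t) ⊓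
      (Y.map (shear (minor E y a b) y t)).map (tau E 𝔽) < X ⊓ Y.map (tau E 𝔽) := by
  rcases hXY with hXY | hXY
  · exact exists_shear_lt_of_le E 𝔽 hXY h1 h2
  · obtain ⟨y, a, b, h⟩ := exists_shear_lt_of_le E 𝔽 hXY
      (fun h => h1 (by rw [← inf_map_tau_eq, h, Submodule.map_bot]))
      (fun h => h2 (by rw [← sup_map_tau_eq, h, map_tau_top]))
    refine ⟨y, a, b, fun t ht => ?_⟩
    have := h t ht
    rwa [← map_tau_lt E 𝔽, inf_map_tau_eq, inf_map_tau_eq] at this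

/-- The shear is a rank one update of the identity with determinant 1 + tξ(y) = 1. Once m exceeds a
and b and y lies in `lo E m`, it lives in the first m coordinates. -/
theorem exists_slHom_eq_shear (E : Basis ℕ ℂ V) (y : V) (a b : ℕ) :
    ∃ m₀, ∀ m ≥ m₀, ∃ A : ℝ → Matrix.SpecialLinearGroup (Fin m) ℂ, Continuous A ∧ A 0 = 1 ∧
      ∀ t, (slHom E m (A t)).val = shear (minor E y a b) y t := by
  obtain ⟨n, hn⟩ := exists_mem_lo E y
  refine ⟨max n (max (a + 1) (b + 1)), fun m hm => ?_⟩
  have hy : trunc E m y = y := mem_lo.1 (lo_mono (by omega) hn)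
  let r : Fin m → ℂ := fun j => minor E y a b (E j)
  have hr : ∀ v, r ⬝ᵥ coords E m v = minor E y a b v := by
    intro v
    have e1 : r ⬝ᵥ coords E m v = minor E y a b (trunc E m v) := by
      rw [← emb_coords, emb, Fintype.linearCombination_apply, map_sum, dotProduct]
      exact Finset.sum_congr rfl fun i _ => by rw [map_smul, smul_eq_mul, mul_comm]
    have e2 : ∀ i < m, E.repr (trunc E m v) i = E.repr v i := fun i hi =>
      congrFun (coords_trunc E m v) ⟨i, hi⟩
    rw [e1, minor_apply, minor_apply, e2 a (by omega), e2 b (by omega)]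
  let M : ℝ → Matrix (Fin m) (Fin m) ℂ := fun t =>
    1 + Matrix.replicateCol Unit ((t : ℂ) • coords E m y) * Matrix.replicateRow Unit r
  have hM : ∀ t, (M t).det = 1 := fun t => by
    rw [Matrix.det_one_add_replicateCol_mul_replicateRow, dotProduct_smul, hr, minor_self,
      smul_zero, add_zero]
  refine ⟨fun t => ⟨M t, hM t⟩, ?_, ?_, fun t => ?_⟩
  · refine Continuous.subtype_mk ?_ _
    refine continuous_matrix fun i j => ?_
    simp only [M, Matrix.add_apply, Matrix.mul_apply, Matrix.replicateCol_apply,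
      Matrix.replicateRow_apply, Pi.smul_apply, smul_eq_mul]
    fun_prop
  · apply Subtype.ext
    ext i j
    simp [M, Matrix.mul_apply]
  · refine LinearMap.ext fun v => ?_
    change matrixMap E m (M t) v = _
    rw [matrixMap_apply, shear_apply]
    have e3 : (M t).mulVec (coords E m v) =
        coords E m v + ((t : ℂ) * minor E y a b v) • coords E m y := by
      rw [← hr, show M t = 1 + Matrix.replicateCol Unit ((t : ℂ) • coords E m y) *
        Matrix.replicateRow Unit r from rfl, Matrix.add_mulVec, Matrix.one_mulVec]
      congr 1
      ext i
      simp only [Pi.smul_apply, smul_eq_mul, Matrix.mulVec, dotProduct, Matrix.mul_apply,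
        Matrix.replicateCol_apply, Matrix.replicateRow_apply, Finset.univ_unique,
        Finset.sum_singleton, Finset.mul_sum, Finset.sum_mul]
      exact Finset.sum_congr rfl fun j _ => by ring
    rw [e3, map_add, map_smul, emb_coords, emb_coords, hy]
    abel

/-- Nondegenerate flags are in general position to their images under `τ`. -/
theorem isTransversal_of_isNondegenerate {E : Basis ℕ ℂ V} {𝔽 : ScalarCase}
    {𝓕 : Set (Submodule ℂ V)} {L : FlagManifold E 𝓕} (hL : IsNondegenerate 𝔽 L) :
    IsTransversal E 𝔽 L.1 := by
  intro W hW W' hW'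
  by_contra! h
  obtain ⟨y, a, b, hs⟩ := exists_shear_lt E 𝔽 (L.2.1.chain W hW W' hW') h.1 h.2
  obtain ⟨m, hm⟩ := exists_slHom_eq_shear E y a b
  obtain ⟨A, -, -, hA⟩ := hm m le_rfl
  refine hL (FlagManifold.move (slHom_mem E (A 1)) L) (moveEquiv _ L.1)
    (isCommensuration_moveEquiv (slHom_mem E (A 1)) L.1) ⟨W, hW⟩ ⟨W', hW'⟩ ?_
  have := hs 1 one_ne_zero
  rw [← hA] at this
  exact this

/-! ### Open orbits -/

theorem isOpen_iff {E : Basis ℕ ℂ V} {𝓕 : Set (Submodule ℂ V)} (hflag : IsGeneralizedFlag 𝓕)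
    (hcomp : IsCompatible E 𝓕) (D : Set (FlagManifold E 𝓕)) :
    IsOpen D ↔ ∀ n, IsOpen {A : Matrix.SpecialLinearGroup (Fin n) ℂ |
      (FlagManifold.base hflag hcomp).move (slHom_mem E A) ∈ D} := by
  have h1 : IsOpen D ↔ ∃ t : Set (Set (Submodule ℂ V)),
      (∀ n, IsOpen ((fun A : Matrix.SpecialLinearGroup (Fin n) ℂ => moveFlag (slHom E n A) 𝓕) ⁻¹' t))
        ∧ Subtype.val ⁻¹' t = D := by
    let _ : TopologicalSpace (Set (Submodule ℂ V)) := ⨆ n : ℕ, TopologicalSpace.coinduced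
      (fun A : Matrix.SpecialLinearGroup (Fin n) ℂ => moveFlag (slHom E n A) 𝓕) inferInstance
    refine (isOpen_induced_iff (f := Subtype.val)).trans ?_
    simp only [isOpen_iSup_iff, isOpen_coinduced]
  rw [h1]
  constructor
  · rintro ⟨t, ht, rfl⟩ n
    exact ht n
  · intro h
    refine ⟨Subtype.val '' D, fun n => ?_, Set.preimage_image_eq _ Subtype.val_injective⟩
    convert h n using 1
    ext A
    constructor
    · rintro ⟨M, hM, hMA⟩
      have : M = (FlagManifold.base hflag hcomp).move (slHom_mem E A) := Subtype.ext hMA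
      rwa [this] at hM
    · intro hA
      exact ⟨_, hA, rfl⟩

theorem map_tau_map_of_mem_realForm {E : Basis ℕ ℂ V} {𝔽 : ScalarCase}
    {g : LinearMap.GeneralLinearGroup ℂ V} (hg : g ∈ realForm E 𝔽) (X : Submodule ℂ V) :
    (X.map g.val).map (tau E 𝔽) = (X.map (tau E 𝔽)).map g.val := by
  ext v
  constructor
  · rintro ⟨_, ⟨w, hw, rfl⟩, rfl⟩
    exact ⟨_, ⟨w, hw, rfl⟩, hg.2 w⟩
  · rintro ⟨_, ⟨w, hw, rfl⟩, rfl⟩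
    exact ⟨_, ⟨w, hw, rfl⟩, (hg.2 w).symm⟩

/-- A small shear of L stays in an open orbit, so it has the same effect on each member as some g in
G₀. Then g(W ∩ τW') would be a proper subspace of W ∩ τW', against `IsComm.eq_of_le`. -/
theorem isTransversal_of_isOpen_realOrbit {E : Basis ℕ ℂ V} {𝔽 : ScalarCase}
    {𝓕 : Set (Submodule ℂ V)} (hflag : IsGeneralizedFlag 𝓕) (hcomp : IsCompatible E 𝓕)
    {L : FlagManifold E 𝓕} (hL : IsOpen (realOrbit 𝔽 L)) : IsTransversal E 𝔽 L.1 := by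
  intro W hW W' hW'
  by_contra! h
  obtain ⟨y, a, b, hs⟩ := exists_shear_lt E 𝔽 (L.2.1.chain W hW W' hW') h.1 h.2
  obtain ⟨m, hm⟩ := exists_slHom_eq_shear E y a b
  obtain ⟨g, hg, hgL⟩ := FlagManifold.exists_eq_moveFlag hflag hcomp L
  obtain ⟨k, hk⟩ := exists_slHom_range E hg
  obtain ⟨A, hAc, hA0, hA⟩ := hm (max m k) (le_max_left _ _)
  obtain ⟨B, rfl⟩ := hk (max m k) (le_max_right _ _)
  have hopen := (isOpen_iff hflag hcomp _).1 hL (max m k)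
  have hev : ∀ᶠ t in 𝓝 (0 : ℝ), A t * B ∈ {A : Matrix.SpecialLinearGroup (Fin (max m k)) ℂ |
      (FlagManifold.base hflag hcomp).move (slHom_mem E A) ∈ realOrbit 𝔽 L} := by
    have hc : Continuous fun t => A t * B := hAc.mul continuous_const
    refine hc.continuousAt.eventually_mem (hopen.mem_nhds ?_)
    refine ⟨1, one_mem _, ?_⟩
    rw [hA0, one_mul, moveFlag_one, hgL]
    rfl
  obtain ⟨t, ht, ht0⟩ := ((hev.filter_mono nhdsWithin_le_nhds).and
    (self_mem_nhdsWithin : {(0 : ℝ)}ᶜ ∈ 𝓝[≠] (0 : ℝ))).exists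
  obtain ⟨g, hg, hgM⟩ := ht
  have e1 : moveFlag (slHom E _ (A t)) L.1 = moveFlag g L.1 := by
    rw [← hgM, hgL, ← moveFlag_mul, ← map_mul]
    rfl
  have e2 := map_eq_of_moveFlag_eq (slHom_mem E (A t)) hg.1 L.2.1 e1 hW
  have e3 := map_eq_of_moveFlag_eq (slHom_mem E (A t)) hg.1 L.2.1 e1 hW'
  have hlt := hs t ht0
  rw [← hA, e2, e3, map_tau_map_of_mem_realForm hg, ← Submodule.map_inf _ (gl_injective g)] at hlt
  obtain ⟨n, C, rfl⟩ := hg.1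
  exact hlt.ne ((isComm_map_slHom E C _).symm.eq_of_le hlt.le)

/-! ### Dimensions in general position -/

section Dimensions

variable {E : Basis ℕ ℂ V} {𝔽 : ScalarCase} {m : ℕ}

theorem finrank_lo (E : Basis ℕ ℂ V) (m : ℕ) : finrank ℂ (lo E m) = m := by
  rw [lo, LinearMap.finrank_range_of_inj (emb_injective E m), finrank_fin_fun]

theorem finrank_add_le (X Y : Submodule ℂ V) :
    finrank ℂ ↥(X ⊓ lo E m) + finrank ℂ ↥(Y ⊓ lo E m) ≤
      m + finrank ℂ ↥((X ⊓ lo E m) ⊓ (Y ⊓ lo E m)) := by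
  rw [← Submodule.finrank_sup_add_finrank_inf_eq]
  have : finrank ℂ ↥(X ⊓ lo E m ⊔ Y ⊓ lo E m) ≤ finrank ℂ (lo E m) :=
    Submodule.finrank_mono (sup_le inf_le_right inf_le_right)
  rw [finrank_lo] at this
  omega

theorem inf_lo_sup_inf_lo {X Y : Submodule ℂ V} (hX : IsSplit E m X) (hY : IsSplit E m Y)
    (h : X ⊔ Y = ⊤) : (X ⊓ lo E m) ⊔ (Y ⊓ lo E m) = lo E m := by
  refine le_antisymm (sup_le inf_le_right inf_le_right) fun v hv => ?_
  obtain ⟨x, hx, y, hy, rfl⟩ := Submodule.mem_sup.1 (h ▸ Submodule.mem_top : v ∈ X ⊔ Y)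
  rw [← mem_lo.1 hv, map_add]
  exact Submodule.add_mem_sup ⟨hX x hx, trunc_mem_lo _⟩ ⟨hY y hy, trunc_mem_lo _⟩

/-- The least dimension possible for the intersection. The truncated subtraction covers both
alternatives: if X ∩ Y = 0, the dimensions add up to at most m. -/
theorem finrank_inf_eq {X Y : Submodule ℂ V} (hX : IsSplit E m X) (hY : IsSplit E m Y)
    (h : X ⊓ Y = ⊥ ∨ X ⊔ Y = ⊤) :
    finrank ℂ ↥((X ⊓ lo E m) ⊓ (Y ⊓ lo E m)) =
      finrank ℂ ↥(X ⊓ lo E m) + finrank ℂ ↥(Y ⊓ lo E m) - m := by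
  rcases h with h | h
  · have h1 : (X ⊓ lo E m) ⊓ (Y ⊓ lo E m) = ⊥ :=
      le_bot_iff.1 ((inf_le_inf inf_le_left inf_le_left).trans h.le)
    have h2 := finrank_add_le (E := E) (m := m) X Y
    rw [h1, finrank_bot] at h2 ⊢
    omega
  · have h1 := Submodule.finrank_sup_add_finrank_inf_eq (X ⊓ lo E m) (Y ⊓ lo E m)
    rw [inf_lo_sup_inf_lo hX hY h, finrank_lo] at h1
    omega

theorem finrank_map_tau_inf_lo (hm : Even m) (X : Submodule ℂ V) :
    finrank ℂ ↥(X.map (tau E 𝔽) ⊓ lo E m) = finrank ℂ ↥(X ⊓ lo E m) := by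
  rw [← map_tau_lo E 𝔽 hm, ← map_tau_inf, finrank_map_tau, map_tau_lo E 𝔽 hm]

theorem map_tau_inf_hi (hm : Even m) (X : Submodule ℂ V) :
    X.map (tau E 𝔽) ⊓ hi E m = (X ⊓ hi E m).map (tau E 𝔽) := by
  rw [map_tau_inf, map_tau_hi E 𝔽 hm]

theorem exists_even_ge (m : ℕ) : ∃ n ≥ m, Even n := ⟨2 * m, by omega, even_two_mul m⟩

/-- Flags in general position to their images under `τ` are nondegenerate. -/
theorem isNondegenerate_of_isTransversal {𝓕 : Set (Submodule ℂ V)} {L : FlagManifold E 𝓕}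
    (hL : IsTransversal E 𝔽 L.1) : IsNondegenerate 𝔽 L := by
  intro M φ hφ W W' hlt
  rcases hL _ W.2 _ W'.2 with h | h
  · rw [h] at hlt
    exact not_lt_bot hlt
  obtain ⟨m₀, hm₀⟩ := exists_normal_form L.2.1 L.2.2.2.1 M.2.1 M.2.2.2.1 hφ
  obtain ⟨m, hm, heven⟩ := exists_even_ge m₀
  obtain ⟨s1, s1', t1, -, c1⟩ := hm₀ m hm W
  obtain ⟨s2, s2', t2, -, c2⟩ := hm₀ m hm W'
  have r1 := isSplit_map_tau E 𝔽 heven s2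
  have r1' := isSplit_map_tau E 𝔽 heven s2'
  have d1 := finrank_inf_eq s1 r1 (Or.inr h)
  have d2 := finrank_add_le (E := E) (m := m) (φ W).1 ((φ W').1.map (tau E 𝔽))
  rw [finrank_map_tau_inf_lo heven, c1.2.2, c2.2.2] at d1
  rw [finrank_map_tau_inf_lo heven] at d2
  -- In the first m coordinates W ∩ τW' already has the least possible dimension, so nothing can be
  -- lost there; beyond m the two flags agree.
  have e1 : (φ W).1 ⊓ lo E m ⊓ ((φ W').1.map (tau E 𝔽) ⊓ lo E m) =
      W.1 ⊓ lo E m ⊓ (W'.1.map (tau E 𝔽) ⊓ lo E m) := by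
    refine Submodule.eq_of_le_of_finrank_le ?_ (by omega)
    rw [← inf_inf_distrib_right, ← inf_inf_distrib_right]
    exact inf_le_inf_right _ hlt.le
  refine hlt.not_ge fun v hv => ?_
  have hv1 : trunc E m v ∈ W.1 ⊓ lo E m ⊓ (W'.1.map (tau E 𝔽) ⊓ lo E m) :=
    ⟨⟨s1 v hv.1, trunc_mem_lo v⟩, r1 v hv.2, trunc_mem_lo v⟩
  rw [← e1] at hv1
  have hv2 : v - trunc E m v ∈ W.1 ⊓ hi E m :=
    ⟨sub_mem hv.1 (s1 v hv.1), sub_trunc_mem_hi v⟩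
  have hv3 : v - trunc E m v ∈ W'.1.map (tau E 𝔽) ⊓ hi E m :=
    ⟨sub_mem hv.2 (r1 v hv.2), sub_trunc_mem_hi v⟩
  rw [t1] at hv2
  rw [map_tau_inf_hi heven, t2, ← map_tau_inf_hi heven] at hv3
  have := add_mem (show trunc E m v ∈ (φ W).1 ⊓ (φ W').1.map (tau E 𝔽) from ⟨hv1.1.1, hv1.2.1⟩)
    (show v - trunc E m v ∈ (φ W).1 ⊓ (φ W').1.map (tau E 𝔽) from ⟨hv2.1, hv3.1⟩)
  rwa [add_sub_cancel] at this

end Dimensions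

/-! ### Transitivity of the real form on flags in general position -/

section Transitivity

theorem eq_moveFlag_of_forall {L M : Set (Submodule ℂ V)} {g : LinearMap.GeneralLinearGroup ℂ V}
    (φ : L ≃ M) (h : ∀ W : L, W.1.map g.val = (φ W).1) : M = moveFlag g L := by
  ext Y
  constructor
  · intro hY
    refine ⟨(φ.symm ⟨Y, hY⟩).1, (φ.symm ⟨Y, hY⟩).2, ?_⟩
    simp only [h, Equiv.apply_symm_apply]
  · rintro ⟨W, hW, rfl⟩
    simp only [h ⟨W, hW⟩]
    exact (φ _).2

theorem tauFin_real_apply (E : Basis ℕ ℂ V) {m : ℕ} (x : Fin m → ℂ) (i : Fin m) :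
    tauFin E .real m x i = starRingEnd ℂ (x i) := by
  change E.repr (tau E .real (emb E m x)) i = _
  rw [← Complex.conj_conj (E.repr (tau E .real (emb E m x)) i), conj_repr_tau_real]
  exact congrArg _ (congrFun (coords_emb E m x) i)

theorem exists_det_eq_ofReal (E : Basis ℕ ℂ V) (𝔽 : ScalarCase) {m : ℕ} (hm : Even m)
    {k : (Fin m → ℂ) →ₗ[ℂ] (Fin m → ℂ)} (hk : ∀ x, k (tauFin E 𝔽 m x) = tauFin E 𝔽 m (k x)) :
    ∃ r : ℝ, LinearMap.det k = r ∧ (𝔽 = .quaternion → 0 ≤ r) := by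
  cases 𝔽 with
  | real =>
    have h1 : (LinearMap.toMatrix' k).map (starRingEnd ℂ) = LinearMap.toMatrix' k := by
      ext i j
      have h0 : tauFin E .real m (Pi.single j 1) = Pi.single j 1 := by
        ext l
        rw [tauFin_real_apply, Pi.single_apply]
        split_ifs <;> simp
      have h1 : starRingEnd ℂ (k (Pi.single j 1) i) = k (Pi.single j 1) i := by
        rw [← tauFin_real_apply E, ← hk, h0]
      rw [Matrix.map_apply, LinearMap.toMatrix'_apply]
      exact h1
    have h2 : starRingEnd ℂ (LinearMap.det k) = LinearMap.det k := by
      rw [← LinearMap.det_toMatrix', RingHom.map_det]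
      exact congrArg Matrix.det h1
    obtain ⟨r, hr⟩ := Complex.conj_eq_iff_real.1 h2
    exact ⟨r, hr, by simp⟩
  | quaternion =>
    obtain ⟨r, h0, hr⟩ := exists_det_eq_ofReal_nonneg (tauFin E .quaternion m) k
      (fun w => by rw [tauFin_tauFin E _ hm, tauSign, neg_one_smul]) hk
    exact ⟨r, hr, fun _ => h0⟩

theorem matrixMap_diagonal_basis (E : Basis ℕ ℂ V) {n : ℕ} (d : ℕ → ℂ) (hd : ∀ j, n ≤ j → d j = 1)
    (j : ℕ) : matrixMap E n (Matrix.diagonal fun i : Fin n => d i) (E j) = d j • E j := by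
  rcases lt_or_ge j n with h | h
  · rw [show E j = E ((⟨j, h⟩ : Fin n) : ℕ) from rfl, matrixMap_lt]
    simp [Matrix.diagonal_apply]
  · rw [matrixMap_ge E _ h, hd j h, one_smul]

/-- A diagonal element of the general linear group over the real numbers or the quaternions with
given determinant that fixes the first `m` basis vectors. -/
theorem exists_diagonal_commute_tau (E : Basis ℕ ℂ V) (𝔽 : ScalarCase) {m : ℕ} (hm : Even m) (r : ℝ)
    (hr : 𝔽 = .quaternion → 0 ≤ r) :
    ∃ d : ℕ → ℂ, (∀ j < m, d j = 1) ∧ (∀ j, m + 2 ≤ j → d j = 1) ∧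
      ∏ i : Fin (m + 2), d i = r ∧
      ∀ v, matrixMap E (m + 2) (Matrix.diagonal fun i : Fin (m + 2) => d i) (tau E 𝔽 v) =
        tau E 𝔽 (matrixMap E (m + 2) (Matrix.diagonal fun i : Fin (m + 2) => d i) v) := by
  have general : ∀ p q : ℝ, p * q = r → (𝔽 = .quaternion → p = q) → ∃ d : ℕ → ℂ,
      (∀ j < m, d j = 1) ∧ (∀ j, m + 2 ≤ j → d j = 1) ∧
      ∏ i : Fin (m + 2), d i = r ∧
      ∀ v, matrixMap E (m + 2) (Matrix.diagonal fun i : Fin (m + 2) => d i) (tau E 𝔽 v) =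
        tau E 𝔽 (matrixMap E (m + 2) (Matrix.diagonal fun i : Fin (m + 2) => d i) v) := by
    intro p q hpq hq
    -- As m is even, the coordinates m and m + 1 form one quaternionic pair, whence the condition p
    -- = q in that case.
    let d' : ℕ → ℝ := fun j => if j = m then p else if j = m + 1 then q else 1
    have h0 : ∀ j, j ≠ m → j ≠ m + 1 → d' j = 1 := fun j h1 h2 => by simp [d', h1, h2]
    have hge : ∀ j, m + 2 ≤ j → (d' j : ℂ) = 1 := fun j hj => by
      rw [h0 j (by omega) (by omega), Complex.ofReal_one]
    refine ⟨fun j => (d' j : ℂ), fun j hj => ?_, hge, ?_, fun v => ?_⟩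
    · change (d' j : ℂ) = 1
      rw [h0 j (by omega) (by omega), Complex.ofReal_one]
    · rw [Fin.prod_univ_castSucc, Fin.prod_univ_castSucc]
      have : ∀ i : Fin m, d' i = 1 := fun i => h0 _ (by omega) (by omega)
      simp only [Fin.val_castSucc, this, Complex.ofReal_one, Finset.prod_const_one, one_mul,
        Fin.val_last]
      simp only [d', if_true, Nat.succ_ne_self, if_false]
      rw [← Complex.ofReal_mul, hpq]
    · induction v using basis_induction E with
      | zero => simp
      | coe j =>
        rw [matrixMap_diagonal_basis E (fun j => (d' j : ℂ)) hge, map_smulₛₗ, Complex.conj_ofReal,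
          tau_basis]
        cases 𝔽 with
        | real => exact matrixMap_diagonal_basis E (fun j => (d' j : ℂ)) hge j
        | quaternion =>
          obtain rfl := hq rfl
          obtain ⟨b, rfl⟩ := hm
          by_cases hj : Even j
          · have h1 : d' (j + 1) = d' j := by
              obtain ⟨a, rfl⟩ := hj
              simp only [d']
              split_ifs <;> first | rfl | omega
            simp only [tauBasis, hj, if_true, map_neg]
            rw [matrixMap_diagonal_basis E (fun j => (d' j : ℂ)) hge, h1, smul_neg]
          · have h1 : d' (j - 1) = d' j := by
              obtain ⟨a, rfl⟩ := Nat.not_even_iff_odd.1 hj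
              simp only [d']
              split_ifs <;> first | rfl | omega
            simp only [tauBasis, hj, if_false]
            rw [matrixMap_diagonal_basis E (fun j => (d' j : ℂ)) hge, h1]
      | add v w hv hw => rw [map_add, map_add, map_add, map_add, hv, hw]
      | smul c v hv => rw [map_smulₛₗ, map_smul, map_smul, map_smulₛₗ, hv]
  cases 𝔽 with
  | real => exact general r 1 (mul_one r) (by simp)
  | quaternion => exact general (√r) (√r) (Real.mul_self_sqrt (hr rfl)) fun _ => rfl

theorem trunc_matrixMap_diagonal (E : Basis ℕ ℂ V) {m n : ℕ} (d : ℕ → ℂ)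
    (hd : ∀ j, n ≤ j → d j = 1) (v : V) :
    trunc E m (matrixMap E n (Matrix.diagonal fun i : Fin n => d i) v) =
      matrixMap E n (Matrix.diagonal fun i : Fin n => d i) (trunc E m v) := by
  induction v using basis_induction E with
  | zero => simp
  | coe j =>
    rw [matrixMap_diagonal_basis E d hd, map_smul]
    rcases lt_or_ge j m with h | h
    · rw [trunc_basis_lt E h, matrixMap_diagonal_basis E d hd]
    · rw [trunc_basis_ge E h, smul_zero, map_zero]
  | add v w hv hw => simp only [map_add, hv, hw]
  | smul c v hv => simp only [map_smul, hv]

theorem matrixMap_diagonal_of_mem_lo (E : Basis ℕ ℂ V) {m n : ℕ} (d : ℕ → ℂ)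
    (hd : ∀ j, n ≤ j → d j = 1) (hd' : ∀ j < m, d j = 1) {v : V} (hv : v ∈ lo E m) :
    matrixMap E n (Matrix.diagonal fun i : Fin n => d i) v = v := by
  obtain ⟨x, rfl⟩ := hv
  simp only [emb, Fintype.linearCombination_apply, map_sum, map_smul]
  refine Finset.sum_congr rfl fun i _ => ?_
  rw [matrixMap_diagonal_basis E d hd, hd' i i.2, one_smul]

theorem tau_matrixMap {E : Basis ℕ ℂ V} {𝔽 : ScalarCase} {m : ℕ} (hm : Even m)
    {A : Matrix (Fin m) (Fin m) ℂ}
    (hA : ∀ x, A.mulVec (tauFin E 𝔽 m x) = tauFin E 𝔽 m (A.mulVec x)) (v : V) :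
    matrixMap E m A (tau E 𝔽 v) = tau E 𝔽 (matrixMap E m A v) := by
  rw [matrixMap_apply, matrixMap_apply, coords_tau E 𝔽 hm, hA, emb_tauFin E 𝔽 hm, map_add, map_sub,
    tau_trunc E 𝔽 hm]

/-- Two pairs of flags `(B, σ B)` and `(B', σ B')` that are conjugate are conjugate by a map that
commutes with `σ`. -/
theorem exists_commute_tauFin (E : Basis ℕ ℂ V) (𝔽 : ScalarCase) {m : ℕ} (hm : Even m) {ι : Type*}
    (B B' : ι → Submodule ℂ (Fin m → ℂ)) (g : (Fin m → ℂ) ≃ₗ[ℂ] (Fin m → ℂ))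
    (h1 : ∀ i, ∀ x ∈ B i, g x ∈ B' i)
    (h2 : ∀ i, ∀ x ∈ B i, tauFin E 𝔽 m (g (tauFin E 𝔽 m x)) ∈ B' i) :
    ∃ k : (Fin m → ℂ) →ₗ[ℂ] (Fin m → ℂ), Function.Injective k ∧
      (∀ x, k (tauFin E 𝔽 m x) = tauFin E 𝔽 m (k x)) ∧ ∀ i, ∀ x ∈ B i, k x ∈ B' i := by
  -- Since τ⁻¹ is `tauSign 𝔽` times τ, this is τgτ⁻¹. Conjugation by τ exchanges the two terms of
  -- a·g + ā·h.
  let h : (Fin m → ℂ) →ₗ[ℂ] (Fin m → ℂ) :=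
    { toFun := fun x => tauSign 𝔽 • tauFin E 𝔽 m (g (tauFin E 𝔽 m x))
      map_add' := fun x y => by simp only [map_add, smul_add]
      map_smul' := fun c x => by
        simp only [map_smulₛₗ, Complex.conj_conj, RingHom.id_apply]
        rw [smul_comm] }
  have hh : ∀ x, h x = tauSign 𝔽 • tauFin E 𝔽 m (g (tauFin E 𝔽 m x)) := fun _ => rfl
  obtain ⟨a, ha⟩ := exists_injective_smul_add_conj_smul g h
  refine ⟨_, ha, fun x => ?_, fun i x hx => ?_⟩
  · simp only [LinearMap.add_apply, LinearMap.smul_apply, LinearEquiv.coe_coe, hh, map_add]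
    rw [map_smulₛₗ (tauFin E 𝔽 m) a, map_smulₛₗ (tauFin E 𝔽 m) (starRingEnd ℂ a),
      map_smulₛₗ (tauFin E 𝔽 m) (tauSign 𝔽), tauFin_tauFin E 𝔽 hm, tauFin_tauFin E 𝔽 hm,
      map_smul g, map_smulₛₗ (tauFin E 𝔽 m) (tauSign 𝔽), conj_tauSign, Complex.conj_conj,
      smul_smul (tauSign 𝔽), smul_smul (tauSign 𝔽), tauSign_mul_self, one_smul, one_smul, add_comm]
  · exact add_mem (Submodule.smul_mem _ _ (h1 i x hx))
      (Submodule.smul_mem _ _ (Submodule.smul_mem _ _ (h2 i x hx)))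

theorem exists_realForm_eq_moveFlag {E : Basis ℕ ℂ V} {𝔽 : ScalarCase} {𝓕 : Set (Submodule ℂ V)}
    (hflag : IsGeneralizedFlag 𝓕) (hcomp : IsCompatible E 𝓕) {L M : FlagManifold E 𝓕}
    (hL : IsTransversal E 𝔽 L.1) (hM : IsTransversal E 𝔽 M.1) :
    ∃ g ∈ realForm E 𝔽, M.1 = moveFlag g L.1 := by
  obtain ⟨φ, hφ⟩ := L.exists_commensuration M
  obtain ⟨ψ, hψ⟩ := L.2.2.2.2
  obtain ⟨m₁, hm₁⟩ := exists_normal_form L.2.1 L.2.2.2.1 M.2.1 M.2.2.2.1 hφ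
  obtain ⟨m₂, hm₂⟩ := exists_normal_form hflag L.2.2.1 L.2.1 L.2.2.2.1 hψ
  -- L agrees with `𝓕` from coordinate m on, but L and M are matched in m + 2 coordinates: the last
  -- two are kept for correcting the determinant.
  obtain ⟨m, hm, heven⟩ := exists_even_ge (max m₁ m₂)
  have heven' : Even (m + 2) := heven.add even_two
  have hnf := hm₁ (m + 2) (by omega)
  have hfin : ∀ X Y : Submodule ℂ V,
      finrank ℂ ↥(X.comap (emb E (m + 2)) ⊓ (Y.map (tau E 𝔽)).comap (emb E (m + 2))) =
      finrank ℂ ↥((X ⊓ lo E (m + 2)) ⊓ (Y.map (tau E 𝔽) ⊓ lo E (m + 2))) := fun X Y => by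
    rw [← inf_inf_distrib_right]
    exact finrank_comap_emb (X ⊓ Y.map (tau E 𝔽))
  have hτfin : ∀ X : Submodule ℂ V, finrank ℂ ((X.map (tau E 𝔽)).comap (emb E (m + 2))) =
      finrank ℂ (X.comap (emb E (m + 2))) := fun X => by
    rw [finrank_comap_emb, finrank_comap_emb, finrank_map_tau_inf_lo heven']
  obtain ⟨g, hgB, hgC⟩ := exists_equiv_of_chains (ι := L.1) (κ := L.1)
    (fun W => W.1.comap (emb E (m + 2)))
    (fun W => (W.1.map (tau E 𝔽)).comap (emb E (m + 2)))
    (fun W => (φ W).1.comap (emb E (m + 2)))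
    (fun W => ((φ W).1.map (tau E 𝔽)).comap (emb E (m + 2))) rfl
    (fun W W' => (L.2.1.chain _ W.2 _ W'.2).imp (Submodule.comap_mono ·) (Submodule.comap_mono ·))
    (fun W W' => (L.2.1.chain _ W.2 _ W'.2).imp
      (fun h => Submodule.comap_mono (Submodule.map_mono h))
      (fun h => Submodule.comap_mono (Submodule.map_mono h)))
    (fun W W' => (M.2.1.chain _ (φ W).2 _ (φ W').2).imp (Submodule.comap_mono ·)
      (Submodule.comap_mono ·))
    (fun W W' => (M.2.1.chain _ (φ W).2 _ (φ W').2).imp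
      (fun h => Submodule.comap_mono (Submodule.map_mono h))
      (fun h => Submodule.comap_mono (Submodule.map_mono h)))
    (fun W => (hnf W).2.2.2.1)
    (fun W => by rw [hτfin, hτfin]; exact (hnf W).2.2.2.1)
    (fun W W' => by
      rw [hfin, hfin,
        finrank_inf_eq (hnf W).1 (isSplit_map_tau E 𝔽 heven' (hnf W').1) (hL _ W.2 _ W'.2),
        finrank_inf_eq (hnf W).2.1 (isSplit_map_tau E 𝔽 heven' (hnf W').2.1)
          (hM _ (φ W).2 _ (φ W').2),
        finrank_map_tau_inf_lo heven', finrank_map_tau_inf_lo heven', (hnf W).2.2.2.2.2.2,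
        (hnf W').2.2.2.2.2.2])
  obtain ⟨k, hkinj, hkσ, hkB⟩ := exists_commute_tauFin E 𝔽 heven'
    (fun W : L.1 => W.1.comap (emb E (m + 2))) (fun W => (φ W).1.comap (emb E (m + 2))) g
    (fun W x hx => by rw [← hgB W]; exact ⟨x, hx, rfl⟩)
    (fun W x hx => by
      have h1 : tauFin E 𝔽 (m + 2) x ∈ (W.1.map (tau E 𝔽)).comap (emb E (m + 2)) := by
        rw [Submodule.mem_comap, emb_tauFin E 𝔽 heven', tau_mem_map]
        exact hx
      have h2 : g (tauFin E 𝔽 (m + 2) x) ∈ ((φ W).1.map (tau E 𝔽)).comap (emb E (m + 2)) := by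
        rw [← hgC W]; exact ⟨_, h1, rfl⟩
      rw [Submodule.mem_comap, emb_tauFin E 𝔽 heven', ← mem_map_tau]
      exact h2)
  obtain ⟨r, hr, hr0⟩ := exists_det_eq_ofReal E 𝔽 heven' hkσ
  have hr1 : r ≠ 0 := by
    rintro rfl
    have h1 := LinearEquiv.isUnit_det' (LinearEquiv.ofInjectiveEndo k hkinj)
    have h2 : ((LinearEquiv.ofInjectiveEndo k hkinj : (Fin (m + 2) → ℂ) ≃ₗ[ℂ] _) :
      (Fin (m + 2) → ℂ) →ₗ[ℂ] (Fin (m + 2) → ℂ)) = k := LinearMap.ext fun _ => rfl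
    rw [h2, hr, Complex.ofReal_zero] at h1
    exact not_isUnit_zero h1
  obtain ⟨d, hd1, hd2, hdprod, hdτ⟩ := exists_diagonal_commute_tau E 𝔽 heven r⁻¹
    (fun h => inv_nonneg.2 (hr0 h))
  let A : Matrix.SpecialLinearGroup (Fin (m + 2)) ℂ :=
    ⟨LinearMap.toMatrix' k * Matrix.diagonal fun i : Fin (m + 2) => d i, by
      rw [Matrix.det_mul, Matrix.det_diagonal, hdprod, LinearMap.det_toMatrix', hr,
        ← Complex.ofReal_mul, mul_inv_cancel₀ hr1, Complex.ofReal_one]⟩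
  have hA : ∀ v, (slHom E (m + 2) A).val v = matrixMap E (m + 2) (LinearMap.toMatrix' k)
      (matrixMap E (m + 2) (Matrix.diagonal fun i : Fin (m + 2) => d i) v) := fun v => by
    rw [coe_slHom, show A.1 = LinearMap.toMatrix' k * Matrix.diagonal fun i : Fin (m + 2) => d i from rfl,
      matrixMap_mul]
    rfl
  -- The diagonal map fixes `lo E m`, and beyond m the members of L coincide with coordinate
  -- subspaces, which it preserves.
  have hdL : ∀ W : L.1, ∀ v ∈ W.1,
      matrixMap E (m + 2) (Matrix.diagonal fun i : Fin (m + 2) => d i) v ∈ W.1 := by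
    intro W v hv
    obtain ⟨W₀, rfl⟩ := ψ.surjective W
    obtain ⟨-, s, t, -, -⟩ := hm₂ m (by omega) W₀
    have h1 : v - trunc E m v ∈ W₀.1 ⊓ hi E m := by
      rw [t]
      exact ⟨sub_mem hv (s v hv), sub_trunc_mem_hi v⟩
    have h2 : matrixMap E (m + 2) (Matrix.diagonal fun i : Fin (m + 2) => d i) (v - trunc E m v) ∈
        W₀.1 ⊓ hi E m := by
      refine ⟨?_, ?_⟩
      · obtain ⟨S, hS⟩ := exists_eq_span_of_mem hflag hcomp W₀.2
        rw [hS] at h1 ⊢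
        exact matrixMap_diagonal_mem_span E _ S h1.1
      · have h3 := h1.2
        rw [SetLike.mem_coe, mem_hi] at h3 ⊢
        rw [trunc_matrixMap_diagonal E d hd2, h3, map_zero]
    rw [t] at h2
    have h3 := add_mem h2.1 (s v hv)
    rw [map_sub, matrixMap_diagonal_of_mem_lo E d hd2 hd1 (trunc_mem_lo v), sub_add_cancel] at h3
    exact h3
  refine ⟨slHom E (m + 2) A, ⟨slHom_mem E A, fun v => ?_⟩, eq_moveFlag_of_forall φ fun W => ?_⟩
  · rw [hA, hA, hdτ]
    exact tau_matrixMap heven' (fun x => by rw [LinearMap.toMatrix'_mulVec,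
      LinearMap.toMatrix'_mulVec, hkσ]) _
  · refine IsComm.eq_of_le ((isComm_map_slHom E A W.1).symm.trans (hnf W).2.2.2.2) ?_
    rintro _ ⟨v, hv, rfl⟩
    rw [hA]
    refine matrixMap_mem (hnf W).1 (hnf W).2.1 (hnf W).2.2.1 (fun x hx => ?_) (hdL W v hv)
    rw [LinearMap.toMatrix'_mulVec]
    exact hkB W x hx

end Transitivity

/-! ### Openness of general position -/

section Openness

/-- The transversal reference pair X', Z' settles what happens beyond m, where it agrees with X, Z,
and decides which alternative can occur. What remains is that the sum inside `lo E m` have the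
largest possible dimension. -/
theorem transversal_iff {E : Basis ℕ ℂ V} {m : ℕ} {X Z X' Z' : Submodule ℂ V}
    (hX : IsSplit E m X) (hZ : IsSplit E m Z) (hX' : IsSplit E m X') (hZ' : IsSplit E m Z')
    (hXX' : X ⊓ hi E m = X' ⊓ hi E m) (hZZ' : Z ⊓ hi E m = Z' ⊓ hi E m)
    (hdX : finrank ℂ ↥(X ⊓ lo E m) = finrank ℂ ↥(X' ⊓ lo E m))
    (hdZ : finrank ℂ ↥(Z ⊓ lo E m) = finrank ℂ ↥(Z' ⊓ lo E m)) (h : X' ⊓ Z' = ⊥ ∨ X' ⊔ Z' = ⊤) :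
    (X ⊓ Z = ⊥ ∨ X ⊔ Z = ⊤) ↔ min m (finrank ℂ ↥(X ⊓ lo E m) + finrank ℂ ↥(Z ⊓ lo E m)) ≤
      finrank ℂ ↥((X ⊓ lo E m) ⊔ (Z ⊓ lo E m)) := by
  have hsum := Submodule.finrank_sup_add_finrank_inf_eq (X ⊓ lo E m) (Z ⊓ lo E m)
  have hsum' := Submodule.finrank_sup_add_finrank_inf_eq (X' ⊓ lo E m) (Z' ⊓ lo E m)
  constructor
  · intro hXZ
    have := finrank_inf_eq hX hZ hXZ
    omega
  · intro hle
    rcases h with h | h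
    · left
      have h1 : (X' ⊓ lo E m) ⊓ (Z' ⊓ lo E m) = ⊥ :=
        le_bot_iff.1 ((inf_le_inf inf_le_left inf_le_left).trans h.le)
      have h2 := finrank_add_le (E := E) (m := m) X' Z'
      rw [h1, finrank_bot] at h2
      have h3 : (X ⊓ lo E m) ⊓ (Z ⊓ lo E m) = ⊥ := by
        rw [← Submodule.finrank_eq_zero (R := ℂ)]
        omega
      rw [eq_bot_iff]
      intro v hv
      have h4 : trunc E m v ∈ (X ⊓ lo E m) ⊓ (Z ⊓ lo E m) :=
        ⟨⟨hX v hv.1, trunc_mem_lo v⟩, hZ v hv.2, trunc_mem_lo v⟩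
      rw [h3, Submodule.mem_bot] at h4
      have h5 : v ∈ X ⊓ hi E m := ⟨hv.1, mem_hi.2 h4⟩
      have h6 : v ∈ Z ⊓ hi E m := ⟨hv.2, mem_hi.2 h4⟩
      rw [hXX'] at h5
      rw [hZZ'] at h6
      exact h ▸ (⟨h5.1, h6.1⟩ : v ∈ X' ⊓ Z')
    · right
      have h1 := inf_lo_sup_inf_lo hX' hZ' h
      have h2 : (X ⊓ lo E m) ⊔ (Z ⊓ lo E m) = lo E m := by
        refine Submodule.eq_of_le_of_finrank_le (sup_le inf_le_right inf_le_right) ?_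
        rw [h1, finrank_lo] at hsum'
        rw [finrank_lo]
        omega
      rw [eq_top_iff]
      intro v _
      have h3 : trunc E m v ∈ X ⊔ Z :=
        (sup_le_sup inf_le_left inf_le_left : (X ⊓ lo E m) ⊔ (Z ⊓ lo E m) ≤ X ⊔ Z)
          (h2.ge (trunc_mem_lo v))
      obtain ⟨p, hp, q, hq, hpq⟩ := Submodule.mem_sup.1 (h ▸ Submodule.mem_top : v ∈ X' ⊔ Z')
      have h4 : p - trunc E m p ∈ X' ⊓ hi E m := ⟨sub_mem hp (hX' p hp), sub_trunc_mem_hi p⟩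
      have h5 : q - trunc E m q ∈ Z' ⊓ hi E m := ⟨sub_mem hq (hZ' q hq), sub_trunc_mem_hi q⟩
      rw [← hXX'] at h4
      rw [← hZZ'] at h5
      have h6 : v = trunc E m v + ((p - trunc E m p) + (q - trunc E m q)) := by
        rw [← hpq, map_add]; abel
      rw [h6]
      exact add_mem h3 (Submodule.add_mem_sup h4.1 h5.1)

theorem map_slHom_lo (E : Basis ℕ ℂ V) {m : ℕ} (A : Matrix.SpecialLinearGroup (Fin m) ℂ) :
    (lo E m).map (slHom E m A).val = lo E m := by
  refine Submodule.eq_of_le_of_finrank_eq ?_ (finrank_map_of_injective (gl_injective _) _)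
  rintro _ ⟨_, ⟨x, rfl⟩, rfl⟩
  exact ⟨_, (matrixMap_emb E A.1 x).symm⟩

theorem isSplit_map_slHom {E : Basis ℕ ℂ V} {m : ℕ} (A : Matrix.SpecialLinearGroup (Fin m) ℂ)
    {X : Submodule ℂ V} (hX : IsSplit E m X) : IsSplit E m (X.map (slHom E m A).val) := by
  rintro _ ⟨v, hv, rfl⟩
  refine ⟨trunc E m v, hX v hv, ?_⟩
  rw [coe_slHom, ← emb_coords, matrixMap_emb, ← emb_coords, coords_matrixMap]

/-- The span of the vectors `E i` for `i ∈ s`. -/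
noncomputable def lowSpan (E : Basis ℕ ℂ V) (m : ℕ) (s : Set (Fin m)) : Submodule ℂ V :=
  Submodule.span ℂ (Set.range fun i : s => E (i : Fin m))

theorem span_inf_lo_eq_lowSpan (E : Basis ℕ ℂ V) (m : ℕ) (S : Set ℕ) :
    Submodule.span ℂ (E '' S) ⊓ lo E m = lowSpan E m {i | (i : ℕ) ∈ S} := by
  apply le_antisymm
  · rintro v ⟨hv, hv'⟩
    rw [← mem_lo.1 hv', ← emb_coords, emb, Fintype.linearCombination_apply]
    refine sum_mem fun i _ => ?_
    by_cases h0 : coords E m v i = 0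
    · rw [h0, zero_smul]; exact zero_mem _
    · refine Submodule.smul_mem _ _ (Submodule.subset_span ⟨⟨i, ?_⟩, rfl⟩)
      exact (E.mem_span_image.1 hv) (Finsupp.mem_support_iff.2 h0)
  · refine Submodule.span_le.2 ?_
    rintro _ ⟨i, rfl⟩
    exact ⟨Submodule.subset_span ⟨_, i.2, rfl⟩, mem_lo.2 (trunc_basis_lt E i.1.2)⟩

theorem continuous_dual_slHom (E : Basis ℕ ℂ V) (n : ℕ) (f : Dual ℂ V) (j : ℕ) :
    Continuous fun A : Matrix.SpecialLinearGroup (Fin n) ℂ => f ((slHom E n A).val (E j)) := by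
  rcases lt_or_ge j n with h | h
  · have : (fun A : Matrix.SpecialLinearGroup (Fin n) ℂ => f ((slHom E n A).val (E j))) =
        fun A => ∑ i : Fin n, A.1 i ⟨j, h⟩ * f (E i) := by
      ext A
      rw [coe_slHom, show E j = E ((⟨j, h⟩ : Fin n) : ℕ) from rfl, matrixMap_lt]
      simp
    rw [this]
    refine continuous_finsetSum _ fun i _ => ?_
    have h1 : Continuous fun A : Matrix.SpecialLinearGroup (Fin n) ℂ => A.1 i ⟨j, h⟩ :=
      (continuous_subtype_val (p := fun M : Matrix (Fin n) (Fin n) ℂ => M.det = 1)).matrix_elem i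
        (⟨j, h⟩ : Fin n)
    exact h1.mul continuous_const
  · have : (fun A : Matrix.SpecialLinearGroup (Fin n) ℂ => f ((slHom E n A).val (E j))) =
        fun A => f (E j) := by
      ext A
      rw [coe_slHom, matrixMap_ge E A.1 h]
    rw [this]
    exact continuous_const

/-- The composite of f and τ is conjugate linear, so its complex conjugate is a functional. -/
theorem continuous_dual_tau_slHom (E : Basis ℕ ℂ V) (𝔽 : ScalarCase) (n : ℕ) (f : Dual ℂ V)
    (j : ℕ) : Continuous fun A : Matrix.SpecialLinearGroup (Fin n) ℂ =>
      f (tau E 𝔽 ((slHom E n A).val (E j))) := by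
  let f' : Dual ℂ V :=
    { toFun := fun v => starRingEnd ℂ (f (tau E 𝔽 v))
      map_add' := by simp
      map_smul' := fun c v => by simp [map_smulₛₗ] }
  have : (fun A : Matrix.SpecialLinearGroup (Fin n) ℂ =>
      f (tau E 𝔽 ((slHom E n A).val (E j)))) =
      fun A => starRingEnd ℂ (f' ((slHom E n A).val (E j))) := by
    ext A
    exact (Complex.conj_conj _).symm
  rw [this]
  exact Complex.continuous_conj.comp (continuous_dual_slHom E n f' j)

theorem isOpen_setOf_le_finrank_lowSpan (E : Basis ℕ ℂ V) (𝔽 : ScalarCase) (n m k : ℕ)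
    (s s' : Set (Fin m)) :
    IsOpen {A : Matrix.SpecialLinearGroup (Fin n) ℂ | k ≤ finrank ℂ
      ↥((lowSpan E m s).map (slHom E n A).val ⊔
        ((lowSpan E m s').map (slHom E n A).val).map (tau E 𝔽))} := by
  have h := isOpen_setOf_le_finrank_span
    (fun (A : Matrix.SpecialLinearGroup (Fin n) ℂ) (i : s ⊕ s') =>
      Sum.elim (fun i : s => (slHom E n A).val (E (i : Fin m)))
        (fun i : s' => tau E 𝔽 ((slHom E n A).val (E (i : Fin m)))) i)
    (fun f i => by
      rcases i with i | i
      · exact continuous_dual_slHom E n f _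
      · exact continuous_dual_tau_slHom E 𝔽 n f _) k
  convert h using 3 with A
  rw [Set.Sum.elim_range, Submodule.span_union, lowSpan, lowSpan, Submodule.map_span,
    Submodule.map_span, Submodule.map_span, ← Set.range_comp, ← Set.range_comp, ← Set.range_comp]
  rfl

/-- The flag L serves as the reference in `transversal_iff`. The condition on a pair of members of
`𝓕` depends only on which of the first m basis vectors they contain, so the intersection of open
sets is finite even for infinite `𝓕`. -/
theorem isOpen_setOf_isTransversal {E : Basis ℕ ℂ V} {𝔽 : ScalarCase} {𝓕 : Set (Submodule ℂ V)}
    (hflag : IsGeneralizedFlag 𝓕) (hcomp : IsCompatible E 𝓕) {L : FlagManifold E 𝓕}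
    (hL : IsTransversal E 𝔽 L.1) : IsOpen {M : FlagManifold E 𝓕 | IsTransversal E 𝔽 M.1} := by
  rw [isOpen_iff hflag hcomp]
  intro n
  obtain ⟨ψ, hψ⟩ := L.2.2.2.2
  obtain ⟨m₀, hm₀⟩ := exists_normal_form hflag L.2.2.1 L.2.1 L.2.2.2.1 hψ
  obtain ⟨m, hm, heven⟩ := exists_even_ge (max m₀ n)
  have hnf := hm₀ m (by omega)
  let ind : 𝓕 → Set (Fin m) := fun W => {i | E i ∈ W.1}
  have hind : ∀ W : 𝓕, W.1 ⊓ lo E m = lowSpan E m (ind W) := by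
    intro W
    obtain ⟨S, hS⟩ := exists_eq_span_of_mem hflag hcomp W.2
    have h1 : ind W = {i : Fin m | (i : ℕ) ∈ S} := by
      ext i
      change E i ∈ W.1 ↔ (i : ℕ) ∈ S
      rw [hS]
      rw [E.mem_span_image, E.repr_self, Finsupp.support_single _ one_ne_zero]
      simp
    rw [h1, hS, span_inf_lo_eq_lowSpan]
  let O : Set (Fin m) × Set (Fin m) → Set (Matrix.SpecialLinearGroup (Fin n) ℂ) := fun p =>
    {A | min m (finrank ℂ (lowSpan E m p.1) + finrank ℂ (lowSpan E m p.2)) ≤ finrank ℂ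
      ↥((lowSpan E m p.1).map (slHom E n A).val ⊔
        ((lowSpan E m p.2).map (slHom E n A).val).map (tau E 𝔽))}
  have key : {A : Matrix.SpecialLinearGroup (Fin n) ℂ |
      (FlagManifold.base hflag hcomp).move (slHom_mem E A) ∈
        {M : FlagManifold E 𝓕 | IsTransversal E 𝔽 M.1}} =
      ⋂ p ∈ Set.range fun q : 𝓕 × 𝓕 => (ind q.1, ind q.2), O p := by
    ext A
    have h1 : ∀ W W' : 𝓕, A ∈ O (ind W, ind W') ↔
        (W.1.map (slHom E n A).val ⊓ (W'.1.map (slHom E n A).val).map (tau E 𝔽) = ⊥ ∨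
          W.1.map (slHom E n A).val ⊔ (W'.1.map (slHom E n A).val).map (tau E 𝔽) = ⊤) := by
      intro W W'
      obtain ⟨A', hA'⟩ := slHom_range_mono E (show n ≤ m by omega) ⟨A, rfl⟩
      have hA' : slHom E n A = slHom E m A' := hA'.symm
      change min m (finrank ℂ (lowSpan E m (ind W)) + finrank ℂ (lowSpan E m (ind W'))) ≤ finrank ℂ
        ↥((lowSpan E m (ind W)).map (slHom E n A).val ⊔
          ((lowSpan E m (ind W')).map (slHom E n A).val).map (tau E 𝔽)) ↔ _
      rw [hA', ← hind, ← hind]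
      have e1 : ∀ X : Submodule ℂ V, (X ⊓ lo E m).map (slHom E m A').val =
          X.map (slHom E m A').val ⊓ lo E m := fun X => by
        rw [Submodule.map_inf _ (gl_injective _), map_slHom_lo]
      have e2 : ∀ X : Submodule ℂ V, finrank ℂ ↥(X.map (slHom E m A').val ⊓ lo E m) =
          finrank ℂ ↥(X ⊓ lo E m) := fun X => by
        rw [← e1, finrank_map_of_injective (gl_injective _)]
      have e3 : ∀ X : Submodule ℂ V, IsSplit E m X → X.map (slHom E m A').val ⊓ hi E m =
          X ⊓ hi E m := fun X hX =>
        inf_hi_eq_of_sup_lo_eq (isSplit_map_slHom A' hX) hX (isComm_map_slHom E A' X).symm.sup_eq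
      obtain ⟨s1, s2, s3, -, s5⟩ := hnf W
      obtain ⟨t1, t2, t3, -, t5⟩ := hnf W'
      have h2 := transversal_iff (isSplit_map_slHom A' s1)
        (isSplit_map_tau E 𝔽 heven (isSplit_map_slHom A' t1)) s2 (isSplit_map_tau E 𝔽 heven t2)
        (by rw [e3 _ s1, s3]) (by rw [map_tau_inf_hi heven, e3 _ t1, t3, map_tau_inf_hi heven])
        (by rw [e2, s5.2.2])
        (by rw [finrank_map_tau_inf_lo heven, finrank_map_tau_inf_lo heven, e2, t5.2.2])
        (hL _ (ψ W).2 _ (ψ W').2)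
      rw [h2, e1, e1, map_tau_inf, map_tau_lo E 𝔽 heven, finrank_map_tau_inf_lo heven, e2, e2]
    simp only [Set.mem_iInter]
    constructor
    · rintro hA _ ⟨⟨W, W'⟩, rfl⟩
      exact (h1 W W').2 (hA _ ⟨W.1, W.2, rfl⟩ _ ⟨W'.1, W'.2, rfl⟩)
    · rintro hA _ ⟨W, hW, rfl⟩ _ ⟨W', hW', rfl⟩
      exact (h1 ⟨W, hW⟩ ⟨W', hW'⟩).1 (hA _ ⟨(⟨W, hW⟩, ⟨W', hW'⟩), rfl⟩)
  rw [key]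
  exact (Set.toFinite _).isOpen_biInter fun p _ => isOpen_setOf_le_finrank_lowSpan E 𝔽 n m _ p.1 p.2

end Openness

/-! ### The open orbit as the set of transversal flags -/

theorem IsTransversal.moveFlag {E : Basis ℕ ℂ V} {𝔽 : ScalarCase} {L : Set (Submodule ℂ V)}
    (hL : IsTransversal E 𝔽 L) {g : LinearMap.GeneralLinearGroup ℂ V} (hg : g ∈ realForm E 𝔽) :
    IsTransversal E 𝔽 (moveFlag g L) := by
  rintro _ ⟨W, hW, rfl⟩ _ ⟨W', hW', rfl⟩
  dsimp only
  rw [map_tau_map_of_mem_realForm hg, ← Submodule.map_inf _ (gl_injective g), ← Submodule.map_sup]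
  refine (hL W hW W' hW').imp (fun h => by rw [h, Submodule.map_bot]) fun h => ?_
  rw [h, Submodule.map_top, LinearMap.range_eq_top]
  exact gl_surjective g

theorem realOrbit_eq_setOf_isTransversal {E : Basis ℕ ℂ V} {𝔽 : ScalarCase}
    {𝓕 : Set (Submodule ℂ V)} (hflag : IsGeneralizedFlag 𝓕) (hcomp : IsCompatible E 𝓕)
    {L : FlagManifold E 𝓕} (hL : IsTransversal E 𝔽 L.1) :
    realOrbit 𝔽 L = {M | IsTransversal E 𝔽 M.1} := by
  ext M
  constructor
  · rintro ⟨g, hg, hM⟩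
    change IsTransversal E 𝔽 M.1
    rw [hM]
    exact hL.moveFlag hg
  · exact fun hM => exists_realForm_eq_moveFlag hflag hcomp hL hM

end DirectLimitFlag

theorem corollary3p5 {V : Type*} [AddCommGroup V] [Module ℂ V] (E : Module.Basis ℕ ℂ V)
    (𝔽 : DirectLimitFlag.ScalarCase) (𝓕 : Set (Submodule ℂ V))
    (hflag : DirectLimitFlag.IsGeneralizedFlag 𝓕) (hcomp : DirectLimitFlag.IsCompatible E 𝓕) :
    ((∃ D : Set (DirectLimitFlag.FlagManifold E 𝓕), DirectLimitFlag.IsOpenOrbit 𝔽 D) ↔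
      ∃ L : DirectLimitFlag.FlagManifold E 𝓕, DirectLimitFlag.IsNondegenerate 𝔽 L) ∧
    ((∃ L : DirectLimitFlag.FlagManifold E 𝓕, DirectLimitFlag.IsNondegenerate 𝔽 L) →
      ∃! D : Set (DirectLimitFlag.FlagManifold E 𝓕), DirectLimitFlag.IsOpenOrbit 𝔽 D) := by
  have unique : (∃ L : DirectLimitFlag.FlagManifold E 𝓕, DirectLimitFlag.IsNondegenerate 𝔽 L) →
      ∃! D : Set (DirectLimitFlag.FlagManifold E 𝓕), DirectLimitFlag.IsOpenOrbit 𝔽 D := by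
    rintro ⟨L, hL⟩
    have hT := DirectLimitFlag.isTransversal_of_isNondegenerate hL
    have hO := DirectLimitFlag.realOrbit_eq_setOf_isTransversal hflag hcomp hT
    refine ⟨DirectLimitFlag.realOrbit 𝔽 L, ⟨⟨L, rfl⟩, ?_⟩, ?_⟩
    · rw [hO]
      exact DirectLimitFlag.isOpen_setOf_isTransversal hflag hcomp hT
    -- Any other open orbit passes through a transversal flag M, so it is the same set of all
    -- transversal flags.
    · rintro _ ⟨⟨M, rfl⟩, hM⟩
      rw [hO]
      exact DirectLimitFlag.realOrbit_eq_setOf_isTransversal hflag hcomp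
        (DirectLimitFlag.isTransversal_of_isOpen_realOrbit hflag hcomp hM)
  refine ⟨⟨?_, fun h => (unique h).exists⟩, unique⟩
  rintro ⟨_, ⟨L, rfl⟩, hL⟩
  exact ⟨L, DirectLimitFlag.isNondegenerate_of_isTransversal
    (DirectLimitFlag.isTransversal_of_isOpen_realOrbit hflag hcomp hL)⟩
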